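/- Let $\theta\in(0,1)$ be irrational with continued fraction expansion $\theta=[0;a_1,a_2,\dots]$, and let $q_n$ be the denominators of its convergents: $q_0=1$, $q_1=a_1$, $q_n=a_nq_{n-1}+q_{n-2}$ for $n\ge 2$. For $\lambda\in\mathbb R\setminus\{0\}$ and $\beta\in[0,1)$, let $H_{\lambda,\theta,\beta}$ be the bounded operator on $\ell^2(\mathbb Z)$ given by $$[H_{\lambda,\theta,\beta}u](n)=u(n+1)+u(n-1)+\lambda\,v_{\theta,\beta}(n)\,u(n),\qquad v_{\theta,\beta}(n)=\chi_{[1-\theta,1)}(n\theta+\beta \bmod 1),$$ and let $\Sigma_{\lambda,\theta}$ denote its spectrum, which does not depend on $\beta$ (so that $E\in\Sigma_{\lambda,\theta}$ means that $E$ lies in the spectrum of $H_{\lambda,\theta,\beta_0}$ for some $\beta_0\in[0,1)$). For $u:\mathbb Z\to\mathbb C$ and $L\ge 0$ put $$\|u\|_L^2=\sum_{n=0}^{\lfloor L\rfloor}|u(n)|^2+(L-\lfloor L\rfloor)\,|u(\lfloor L\rfloor+1)|^2 .$$ Suppose that for some $B<\infty$ one has $q_n\le B^n$ for every $n\in\mathbb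 N$. Then for every $\lambda\in\mathbb R\setminus\{0\}$ there exist constants $0<\gamma_1,C_1<\infty$ such that for every $E\in\Sigma_{\lambda,\theta}$, every $\beta\in[0,1)$, and every sequence $u:\mathbb Z\to\mathbb C$ satisfying $$u(n+1)+u(n-1)+\lambda\,v_{\theta,\beta}(n)\,u(n)=E\,u(n)\quad(n\in\mathbb Z),\qquad |u(0)|^2+|u(1)|^2=1,$$ one has $$\|u\|_L\ge C_1L^{\gamma_1}$$ for all sufficiently large $L$. -/

import Mathlib

open scoped ENNReal

namespace Sturmian

noncomputable section

/-- The Hilbert space of square-summable complex sequences indexed by the integers. -/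
abbrev ellTwo : Type := lp (fun _ : ℤ => ℂ) 2

open Classical in
/-- The Sturmian sequence: the indicator function of the interval `[1 - θ, 1)`,
evaluated at `n θ + β` modulo `1`. -/
def potential (θ β : ℝ) (n : ℤ) : ℝ :=
  if Int.fract ((n : ℝ) * θ + β) ∈ Set.Ico (1 - θ) 1 then 1 else 0

/-- The difference expression `u(n+1) + u(n-1) + lam * v(n) * u(n)`, on arbitrary sequences. -/
def action (lam θ β : ℝ) (u : ℤ → ℂ) (n : ℤ) : ℂ :=
  u (n + 1) + u (n - 1) + ((lam * potential θ β n : ℝ) : ℂ) * u n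

lemma norm_potential_le (θ β : ℝ) (n : ℤ) : ‖potential θ β n‖ ≤ 1 := by
  unfold potential
  split_ifs <;> simp

/-- Translation `(S_k u)(n) = u(n + k)` as an isometry of the sequence space. -/
def shift (k : ℤ) : ellTwo →ₗᵢ[ℂ] ellTwo where
  toFun u := ⟨fun n => u (n + k), by
    have h : (0 : ℝ) < (2 : ℝ≥0∞).toReal := by norm_num
    exact memℓp_gen (((lp.memℓp u).summable h).comp_injective (add_left_injective k))⟩
  map_add' _ _ := rfl
  map_smul' _ _ := rfl
  norm_map' u := by
    have h : (0 : ℝ) < (2 : ℝ≥0∞).toReal := by norm_num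
    rw [lp.norm_eq_tsum_rpow h, lp.norm_eq_tsum_rpow h]
    congr 1
    exact (Equiv.addRight k).tsum_eq (fun n : ℤ => ‖u n‖ ^ (2 : ℝ≥0∞).toReal)

/-- Multiplication by the Sturmian sequence. -/
def mulPotential (θ β : ℝ) : ellTwo →L[ℂ] ellTwo :=
  lp.mapCLM (K := 1) 2 (E := fun _ : ℤ => ℂ) (F := fun _ : ℤ => ℂ)
    (fun n : ℤ => ((potential θ β n : ℝ) : ℂ) • ContinuousLinearMap.id ℂ ℂ) zero_le_one
    (fun n => by simpa [norm_smul] using norm_potential_le θ β n)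

/-- The Sturmian Schrödinger operator, a bounded operator on the sequence space. -/
def hamiltonian (lam θ β : ℝ) : ellTwo →L[ℂ] ellTwo :=
  (shift 1).toContinuousLinearMap + (shift (-1)).toContinuousLinearMap
    + (lam : ℂ) • mulPotential θ β

/-- The operator acts by the difference expression. -/
theorem hamiltonian_apply (lam θ β : ℝ) (u : ellTwo) (n : ℤ) :
    hamiltonian lam θ β u n = action lam θ β u n := by
  change u (n + 1) + u (n + -1) + (lam : ℂ) * ((potential θ β n : ℂ) * u n) = _
  simp [action, mul_assoc, sub_eq_add_neg]

/-- `u` solves the difference equation `(H - E) u = 0`; no decay of `u` is required. -/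
def IsSolution (lam θ β E : ℝ) (u : ℤ → ℂ) : Prop :=
  ∀ n : ℤ, action lam θ β u n = (E : ℂ) * u n

/-- The normalization `|u(0)|² + |u(1)|² = 1`. -/
def IsNormalized (u : ℤ → ℂ) : Prop :=
  ‖u 0‖ ^ 2 + ‖u 1‖ ^ 2 = 1

/-- The local norm on `[0, L]`, for `0 ≤ L`, interpolated between integers. -/
def localNorm (u : ℤ → ℂ) (L : ℝ) : ℝ :=
  Real.sqrt (∑ n ∈ Finset.range (⌊L⌋₊ + 1), ‖u (n : ℤ)‖ ^ 2
    + (L - (⌊L⌋₊ : ℝ)) * ‖u ((⌊L⌋₊ : ℤ) + 1)‖ ^ 2)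

/-- The denominator `q_n` of the `n`-th continued fraction convergent of `θ`; thus, for
`θ = [0; a₁, a₂, …]`, `q_0 = 1`, `q_1 = a₁` and `q_n = a_n q_{n-1} + q_{n-2}`. -/
def cfDenom (θ : ℝ) (n : ℕ) : ℝ :=
  (GenContFract.of θ).dens n

end

end Sturmian

/-! Read from any point, at any scale, the Sturmian sequence begins with a square: the first 2k
letters are the square of a cyclic rotation of some word `w` of length k, where `w` is one of a few
standard words or a product of two consecutive ones (`exists_startsSquare`). Since transfer matrices
have determinant one, Cayley–Hamilton turns the square into u(j+2k) - t u(j+k) + u(j) = 0, with t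
the trace across `w` (`StartsSquare.recurrence`).

These traces depend only on the partial quotients, `lam` and E, not on the phase. Their recursion
preserves the Fricke–Vogt invariant, and once two suitable traces leave [-2, 2] in an increasing
manner they stay outside forever. This is an open condition on E. It fails on the spectrum: cutting
off an approximate eigenvector and placing it on a long cycle gives a nearby energy where a late
standard word has trace 2 (`not_escapes`). Without escape the invariant bounds all relevant |t| by
some T (`abs_trace_le`, `abs_mixedTrace_one_le`).

Hence |u(j)|² ≤ 2T²(|u(j+k)|² + |u(j+2k)|²). Summing over j < q_{n+2}, with shifts of at least
q_{n+2}, shows that the mass below q_{n+10} exceeds the mass below q_{n+2} by a fixed factor ρ > 1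
(`mass_reproduction`). As q_n ≤ B^n, geometric growth in n is power growth in L. -/

namespace Sturmian

/-! ### Euclidean algorithm and continued fraction denominators. -/

/-- The remainders of the Euclidean algorithm applied to `1` and `θ`. -/
noncomputable def remainder (θ : ℝ) : ℕ → ℝ
  | 0 => 1
  | 1 => θ
  | n + 2 => remainder θ n
      - (⌊remainder θ n / remainder θ (n + 1)⌋₊ : ℝ) * remainder θ (n + 1)

/-- The partial quotients of the Euclidean algorithm applied to `1` and `θ`. -/
noncomputable def quotient (θ : ℝ) (n : ℕ) : ℕ :=
  ⌊remainder θ n / remainder θ (n + 1)⌋₊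

/-- The denominators of the convergents, starting with `q₋₁ = 0`. -/
noncomputable def denom (θ : ℝ) : ℕ → ℕ
  | 0 => 0
  | 1 => 1
  | n + 2 => quotient θ n * denom θ (n + 1) + denom θ n

/-- The numerators of the convergents, starting with `p₋₁ = 1`. -/
noncomputable def numer (θ : ℝ) : ℕ → ℕ
  | 0 => 1
  | 1 => 0
  | n + 2 => quotient θ n * numer θ (n + 1) + numer θ n

lemma remainder_add_two (θ : ℝ) (n : ℕ) :
    remainder θ (n + 2) = remainder θ n - (quotient θ n : ℝ) * remainder θ (n + 1) := by
  rw [remainder, quotient]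

lemma denom_add_two (θ : ℝ) (n : ℕ) :
    denom θ (n + 2) = quotient θ n * denom θ (n + 1) + denom θ n := by
  rw [denom]

lemma denom_mul_sub_numer (θ : ℝ) (n : ℕ) :
    (denom θ n : ℝ) * θ - numer θ n = (-1) ^ (n + 1) * remainder θ n := by
  induction n using Nat.twoStepInduction with
  | zero => simp [denom, numer, remainder]
  | one => simp [denom, numer, remainder]
  | more n h0 h1 =>
    rw [remainder_add_two, denom_add_two, numer]
    push_cast
    have e1 : ((-1 : ℝ)) ^ (n + 1 + 1) = - (-1) ^ (n + 1) := by ring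
    have e2 : ((-1 : ℝ)) ^ (n + 2 + 1) = (-1) ^ (n + 1) := by ring
    rw [e1] at h1
    rw [e2]
    linear_combination (quotient θ n : ℝ) * h1 + h0

section Irrational
variable {θ : ℝ} (hθ : Irrational θ) (hθ01 : θ ∈ Set.Ioo (0 : ℝ) 1)
include hθ hθ01

/-- The claims are proved together: a vanishing remainder would make a multiple of θ an integer, and
irrationality excludes this only once the denominator is known to be nonzero. -/
lemma remainder_pos_and_lt (n : ℕ) :
    0 < remainder θ (n + 1) ∧ remainder θ (n + 1) < remainder θ n ∧ 0 < denom θ (n + 1) := by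
  induction n with
  | zero => exact ⟨by simpa [remainder] using hθ01.1, by simpa [remainder] using hθ01.2, by
      simp [denom]⟩
  | succ n ih =>
    obtain ⟨h1, h2, h3⟩ := ih
    have hq : 1 ≤ quotient θ n := by
      rw [quotient, Nat.one_le_floor_iff, one_le_div h1]
      exact h2.le
    have hden : 0 < denom θ (n + 2) := by
      rw [denom_add_two]
      positivity
    have hle : (quotient θ n : ℝ) ≤ remainder θ n / remainder θ (n + 1) :=
      Nat.floor_le (div_nonneg (h1.le.trans h2.le) h1.le)
    have hlt : remainder θ n / remainder θ (n + 1) < quotient θ n + 1 := Nat.lt_floor_add_one _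
    rw [le_div_iff₀ h1] at hle
    rw [div_lt_iff₀ h1] at hlt
    have hne : remainder θ (n + 2) ≠ 0 := by
      intro h0
      have := denom_mul_sub_numer θ (n + 2)
      rw [h0, mul_zero, sub_eq_zero] at this
      refine (hθ.natCast_mul hden.ne').ne_nat (numer θ (n + 2)) this
    refine ⟨lt_of_le_of_ne ?_ hne.symm, ?_, hden⟩ <;> rw [remainder_add_two] <;> linarith

lemma remainder_pos (n : ℕ) : 0 < remainder θ n := by
  cases n with
  | zero => simp [remainder]
  | succ n => exact (remainder_pos_and_lt hθ hθ01 n).1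

lemma remainder_lt (n : ℕ) : remainder θ (n + 1) < remainder θ n :=
  (remainder_pos_and_lt hθ hθ01 n).2.1

lemma denom_pos (n : ℕ) : 0 < denom θ (n + 1) :=
  (remainder_pos_and_lt hθ hθ01 n).2.2

lemma one_le_quotient (n : ℕ) : 1 ≤ quotient θ n := by
  rw [quotient, Nat.one_le_floor_iff, one_le_div (remainder_pos hθ hθ01 _)]
  exact (remainder_lt hθ hθ01 n).le

lemma denom_add_le (n : ℕ) : denom θ (n + 1) + denom θ n ≤ denom θ (n + 2) := by
  rw [denom_add_two]
  nlinarith [one_le_quotient hθ hθ01 n]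

lemma denom_mono : Monotone (denom θ) := by
  refine monotone_nat_of_le_succ fun n => ?_
  cases n with
  | zero => simp [denom]
  | succ n => exact (Nat.le_add_right _ _).trans (denom_add_le hθ hθ01 n)

lemma le_denom (n : ℕ) : n ≤ denom θ (n + 1) := by
  induction n with
  | zero => simp
  | succ n ih =>
    rcases n with _ | n
    · exact denom_pos hθ hθ01 1
    · exact (add_le_add ih (denom_pos hθ hθ01 n)).trans (denom_add_le hθ hθ01 (n + 1))

lemma two_mul_denom_le (n : ℕ) : 2 * denom θ n ≤ denom θ (n + 2) := by
  have h1 := denom_add_le hθ hθ01 n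
  have h2 : denom θ n ≤ denom θ (n + 1) := denom_mono hθ hθ01 (Nat.le_succ n)
  omega

/-- The Gauss map orbit of θ consists of the ratios of successive Euclidean remainders. -/
lemma intFractPair_stream (n : ℕ) : ∃ b : ℤ,
    GenContFract.IntFractPair.stream θ n = some ⟨b, remainder θ (n + 1) / remainder θ n⟩ := by
  induction n with
  | zero =>
    refine ⟨⌊θ⌋, ?_⟩
    rw [GenContFract.IntFractPair.stream_zero, GenContFract.IntFractPair.of,
      Int.fract_eq_self.2 ⟨hθ01.1.le, hθ01.2⟩]
    simp [remainder]
  | succ n ih =>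
    obtain ⟨b, hb⟩ := ih
    have h1 := remainder_pos hθ hθ01 (n + 1)
    have h0 := remainder_pos hθ hθ01 n
    refine ⟨⌊remainder θ n / remainder θ (n + 1)⌋, ?_⟩
    rw [GenContFract.IntFractPair.stream_succ_of_some hb (div_pos h1 h0).ne',
      GenContFract.IntFractPair.of]
    simp only [inv_div, Option.some.injEq, GenContFract.IntFractPair.mk.injEq, true_and]
    rw [Int.fract, ← natCast_floor_eq_intCast_floor (div_nonneg h0.le h1.le), remainder_add_two,
      quotient]
    field_simp

lemma of_s_get? (n : ℕ) :
    (GenContFract.of θ).s.get? n = some ⟨1, (quotient θ n : ℝ)⟩ := by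
  obtain ⟨b, hb⟩ := intFractPair_stream hθ hθ01 n
  have h1 := remainder_pos hθ hθ01 (n + 1)
  have h0 := remainder_pos hθ hθ01 n
  rw [GenContFract.get?_of_eq_some_of_get?_intFractPair_stream_fr_ne_zero hb (div_pos h1 h0).ne']
  simp only [GenContFract.IntFractPair.of, inv_div]
  rw [← natCast_floor_eq_intCast_floor (div_nonneg h0.le h1.le), quotient]

lemma cfDenom_eq_denom (n : ℕ) : cfDenom θ n = denom θ (n + 1) := by
  induction n using Nat.twoStepInduction with
  | zero => simp [cfDenom, denom]
  | one =>
    rw [cfDenom, GenContFract.first_den_eq (of_s_get? hθ hθ01 0)]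
    simp [denom]
  | more n h0 h1 =>
    rw [cfDenom] at h0 h1 ⊢
    rw [GenContFract.dens_recurrence (of_s_get? hθ hθ01 (n + 1)) h0 h1, denom_add_two θ (n + 1)]
    push_cast
    ring

end Irrational

/-! ### Sturmian factors and standard words. -/

open Classical in
/-- The letter of the Sturmian coding at a point of the circle. -/
noncomputable def letter (θ x : ℝ) : ℝ := if 1 - θ ≤ Int.fract x then 1 else 0

lemma potential_eq_letter (θ β : ℝ) (n : ℤ) : potential θ β n = letter θ (n * θ + β) := by
  simp [potential, letter, Int.fract_lt_one]

lemma letter_add_intCast (θ x : ℝ) (p : ℤ) : letter θ (x + p) = letter θ x := by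
  simp [letter]

/-- The word of length `k` read along the orbit of `x`. -/
noncomputable def factor (θ x : ℝ) (k : ℕ) : List ℝ :=
  (List.range k).map fun i : ℕ => letter θ (x + i * θ)

@[simp] lemma length_factor (θ x : ℝ) (k : ℕ) : (factor θ x k).length = k := by simp [factor]

@[simp] lemma factor_zero (θ x : ℝ) : factor θ x 0 = [] := by simp [factor]

lemma factor_add (θ x : ℝ) (k l : ℕ) :
    factor θ x (k + l) = factor θ x k ++ factor θ (x + k * θ) l := by
  simp only [factor, List.range_add, List.map_append, List.map_map]
  congr 2
  funext i
  simp only [Function.comp, Nat.cast_add]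
  congr 1
  ring

lemma factor_take (θ x : ℝ) {m k : ℕ} (h : m ≤ k) :
    (factor θ x k).take m = factor θ x m := by
  obtain ⟨l, rfl⟩ := Nat.exists_eq_add_of_le h
  rw [factor_add, List.take_append_of_le_length (by simp), List.take_of_length_le (by simp)]

lemma factor_length_of_eq_append {θ x : ℝ} {k : ℕ} {l₁ l₂ : List ℝ}
    (h : factor θ x k = l₁ ++ l₂) : factor θ x l₁.length = l₁ := by
  have hk : l₁.length ≤ k := by
    have := congrArg List.length h
    simp at this
    omega
  rw [← factor_take θ x hk, h]
  simp

/-- The standard words, starting with `s₀ = 0` at index one. -/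
noncomputable def word (θ : ℝ) : ℕ → List ℝ
  | 0 => []
  | 1 => [0]
  | 2 => List.replicate (quotient θ 0 - 1) 0 ++ [1]
  | n + 3 => (List.replicate (quotient θ (n + 1)) (word θ (n + 2))).flatten ++ word θ (n + 1)

lemma word_add_three (θ : ℝ) (n : ℕ) : word θ (n + 3) =
    (List.replicate (quotient θ (n + 1)) (word θ (n + 2))).flatten ++ word θ (n + 1) := by
  rw [word]

/-- Consecutive standard words commute up to their last two letters. The defect survives the
recursion because a word commutes with its own powers; only e and f change places. -/
lemma word_commute (θ : ℝ) (n : ℕ) : ∃ (l : List ℝ) (e f : ℝ),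
    word θ (n + 2) ++ word θ (n + 1) = l ++ [e, f] ∧
    word θ (n + 1) ++ word θ (n + 2) = l ++ [f, e] := by
  induction n with
  | zero =>
    refine ⟨List.replicate (quotient θ 0 - 1) 0, 1, 0, by simp [word], ?_⟩
    simp only [word]
    rw [← List.append_assoc, ← List.replicate_one, ← List.replicate_add, add_comm,
      List.replicate_add, List.append_assoc]
    rfl
  | succ n ih =>
    obtain ⟨l, e, f, h1, h2⟩ := ih
    refine ⟨(List.replicate (quotient θ (n + 1)) (word θ (n + 2))).flatten ++ l, f, e, ?_, ?_⟩
    · rw [word_add_three, List.append_assoc, h2, List.append_assoc]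
    · rw [word_add_three, ← List.append_assoc, List.append_assoc _ l, ← h1, ← List.append_assoc]
      congr 1
      have : ∀ k : ℕ, word θ (n + 2) ++ (List.replicate k (word θ (n + 2))).flatten =
          (List.replicate k (word θ (n + 2))).flatten ++ word θ (n + 2) := by
        intro k
        rw [← List.flatten_cons, ← List.replicate_succ, List.replicate_succ', List.flatten_append]
        simp
      exact this _

/-! ### The two towers of the rotation at each level. -/

/-- Positivity, with a convention at zero that depends on the parity. -/
def IsUpper (n : ℕ) (t : ℝ) : Prop := if Even n then 0 < t else 0 ≤ t

lemma IsUpper.mono {n : ℕ} {s t : ℝ} (h : IsUpper n s) (hst : s ≤ t) : IsUpper n t := by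
  unfold IsUpper at *
  split_ifs at * <;> linarith

/-- The coordinate changes sign with the level. The parity convention keeps every base interval
closed on the left and open on the right in `x`, as is the coding interval. -/
lemma isUpper_succ (n : ℕ) (t : ℝ) : IsUpper (n + 1) t ↔ ¬ IsUpper n (-t) := by
  unfold IsUpper
  by_cases h : Even n <;> simp [h, Nat.even_add_one]

lemma IsUpper.of_pos {n : ℕ} {t : ℝ} (h : 0 < t) : IsUpper n t := by
  unfold IsUpper
  split_ifs <;> linarith

lemma IsUpper.nonneg {n : ℕ} {t : ℝ} (h : IsUpper n t) : 0 ≤ t := by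
  unfold IsUpper at h
  split_ifs at h <;> linarith

/-- The signed coordinate of `x` relative to the point `θ + p`. -/
noncomputable def coord (θ : ℝ) (n : ℕ) (x : ℝ) (p : ℤ) : ℝ := (-1) ^ (n + 1) * (x - θ - p)

lemma coord_succ (θ : ℝ) (n : ℕ) (x : ℝ) (p : ℤ) : coord θ (n + 1) x p = - coord θ n x p := by
  simp only [coord, pow_succ]
  ring

lemma coord_add_long (θ : ℝ) (n : ℕ) (x : ℝ) (p : ℤ) (i : ℕ) :
    coord θ n (x + (i * denom θ (n + 2) : ℕ) * θ) (p + i * numer θ (n + 2)) =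
      coord θ n x p + i * remainder θ (n + 2) := by
  have h := denom_mul_sub_numer θ (n + 2)
  have e : ((-1 : ℝ)) ^ (n + 2 + 1) = (-1) ^ (n + 1) := by ring
  have e2 : ((-1 : ℝ)) ^ (n + 1) * (-1) ^ (n + 1) = 1 := by
    rw [← mul_pow]
    norm_num
  rw [e] at h
  simp only [coord]
  push_cast
  linear_combination (i : ℝ) * (-1) ^ (n + 1) * h + (i : ℝ) * remainder θ (n + 2) * e2

lemma coord_add_short (θ : ℝ) (n : ℕ) (x : ℝ) (p : ℤ) :
    coord θ n (x + (denom θ (n + 1) : ℕ) * θ) (p + numer θ (n + 1)) =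
      coord θ n x p - remainder θ (n + 1) := by
  have h := denom_mul_sub_numer θ (n + 1)
  have e : ((-1 : ℝ)) ^ (n + 1 + 1) = - (-1) ^ (n + 1) := by ring
  have e2 : ((-1 : ℝ)) ^ (n + 1) * (-1) ^ (n + 1) = 1 := by
    rw [← mul_pow]
    norm_num
  rw [e] at h
  simp only [coord]
  push_cast
  linear_combination (-1) ^ (n + 1) * h - remainder θ (n + 1) * e2

/-- At level `n` a long block starts at `x`. -/
def IsLong (θ : ℝ) (n : ℕ) (x : ℝ) : Prop := ∃ p : ℤ,
  IsUpper n (coord θ n x p + remainder θ (n + 2)) ∧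
  ¬ IsUpper n (coord θ n x p + remainder θ (n + 2) - remainder θ (n + 1))

/-- At level `n` a short block starts at `x`. -/
def IsShort (θ : ℝ) (n : ℕ) (x : ℝ) : Prop := ∃ p : ℤ,
  IsUpper n (coord θ n x p + remainder θ (n + 2) - remainder θ (n + 1)) ∧
  ¬ IsUpper n (coord θ n x p - remainder θ (n + 1))

section Irrational
variable {θ : ℝ} (hθ : Irrational θ) (hθ01 : θ ∈ Set.Ioo (0 : ℝ) 1)
include hθ hθ01

lemma length_word (n : ℕ) : (word θ (n + 1)).length = denom θ (n + 1) := by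
  induction n using Nat.twoStepInduction with
  | zero => simp [word, denom]
  | one =>
    have := one_le_quotient hθ hθ01 0
    simp [word, denom]
    omega
  | more n h0 h1 =>
    rw [word_add_three, denom_add_two]
    simp [h0, h1]

/-- The point θ is the common origin of all base intervals, so its forward orbit begins with every
standard word of index at least two. -/
lemma isLong_theta (n : ℕ) : IsLong θ n θ := by
  have h2 := remainder_pos hθ hθ01 (n + 2)
  have h1 : remainder θ (n + 2) < remainder θ (n + 1) := remainder_lt hθ hθ01 (n + 1)
  refine ⟨0, ?_, fun h => ?_⟩
  · simpa [coord] using IsUpper.of_pos h2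
  · have := h.nonneg
    simp [coord] at this
    linarith

/-- The first return to the base, of coordinates from -r_{n+2} to r_{n+1}, exchanges two intervals:
long points move by +r_{n+2}, short ones by -r_{n+1}. -/
lemma IsLong.next {n : ℕ} {x : ℝ} (h : IsLong θ n x) :
    IsLong θ n (x + denom θ (n + 2) * θ) ∨ IsShort θ n (x + denom θ (n + 2) * θ) := by
  obtain ⟨p, h1, h2⟩ := h
  have hp := remainder_pos hθ hθ01 (n + 2)
  have hc := coord_add_long θ n x p 1
  simp only [one_mul, Nat.cast_one] at hc
  by_cases h3 : IsUpper n (coord θ n x p + 2 * remainder θ (n + 2) - remainder θ (n + 1))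
  · refine .inr ⟨p + numer θ (n + 2), ?_, ?_⟩ <;> rw [hc]
    · exact h3.mono (by linarith)
    · exact h2
  · refine .inl ⟨p + numer θ (n + 2), ?_, fun h4 => h3 ?_⟩
    · rw [hc]
      exact h1.mono (by linarith)
    · rw [hc] at h4
      exact h4.mono (by linarith)

lemma IsShort.next {n : ℕ} {x : ℝ} (h : IsShort θ n x) :
    IsLong θ n (x + denom θ (n + 1) * θ) := by
  obtain ⟨p, h1, h2⟩ := h
  have hlt : remainder θ (n + 2) < remainder θ (n + 1) := remainder_lt hθ hθ01 (n + 1)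
  refine ⟨p + numer θ (n + 1), ?_, fun h4 => h2 ?_⟩
  · rw [coord_add_short]
    exact h1.mono (by linarith)
  · rw [coord_add_short] at h4
    exact h4.mono (by linarith)

/-- A short block is a single long block one level down. The long block following it begins with
another copy of the same word, since quotients are at least one. -/
lemma IsShort.isLong_pred {n : ℕ} {x : ℝ} (h : IsShort θ (n + 1) x) :
    IsLong θ n x ∧ IsLong θ n (x + denom θ (n + 2) * θ) := by
  obtain ⟨p, h1, h2⟩ := h
  have hr : remainder θ (n + 3) = _ := remainder_add_two θ (n + 1)
  have ha : (1 : ℝ) ≤ quotient θ (n + 1) := by exact_mod_cast one_le_quotient hθ hθ01 (n + 1)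
  have hp := remainder_pos hθ hθ01 (n + 2)
  rw [isUpper_succ, coord_succ] at h1
  rw [isUpper_succ, coord_succ, not_not] at h2
  change ¬ IsUpper n (-(- coord θ n x p + remainder θ (n + 3) - remainder θ (n + 2))) at h1
  change IsUpper n (-(- coord θ n x p - remainder θ (n + 2))) at h2
  rw [show n + 1 + 1 = n + 2 from rfl] at hr
  have hm : remainder θ (n + 2) ≤ quotient θ (n + 1) * remainder θ (n + 2) :=
    le_mul_of_one_le_left hp.le ha
  refine ⟨⟨p, h2.mono (by linarith), fun h => h1 (h.mono (by linarith))⟩,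
    ⟨p + numer θ (n + 2), ?_, fun h => h1 ?_⟩⟩ <;> have hc := coord_add_long θ n x p 1 <;>
    simp only [one_mul, Nat.cast_one] at hc
  · rw [hc]
    exact h2.mono (by linarith)
  · rw [hc] at h
    exact h.mono (by linarith)

lemma IsLong.pred {n : ℕ} {x : ℝ} (h : IsLong θ (n + 1) x) :
    (∀ i < quotient θ (n + 1), IsLong θ n (x + (i * denom θ (n + 2) : ℕ) * θ)) ∧
      IsShort θ n (x + (quotient θ (n + 1) * denom θ (n + 2) : ℕ) * θ) := by
  obtain ⟨p, h1, h2⟩ := h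
  have hr : remainder θ (n + 3) = remainder θ (n + 1) - _ := remainder_add_two θ (n + 1)
  have hp := remainder_pos hθ hθ01 (n + 2)
  rw [isUpper_succ, coord_succ] at h1
  rw [isUpper_succ, coord_succ, not_not] at h2
  change ¬ IsUpper n (-(- coord θ n x p + remainder θ (n + 3))) at h1
  change IsUpper n (-(- coord θ n x p + remainder θ (n + 3) - remainder θ (n + 2))) at h2
  rw [show n + 1 + 1 = n + 2 from rfl] at hr
  refine ⟨fun i hi => ⟨p + i * numer θ (n + 2), ?_, fun h => h1 ?_⟩,
    ⟨p + quotient θ (n + 1) * numer θ (n + 2), ?_, fun h => h1 ?_⟩⟩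
  · rw [coord_add_long]
    have h3 := remainder_pos hθ hθ01 (n + 3)
    have : 0 ≤ i * remainder θ (n + 2) := by positivity
    exact h2.mono (by linarith)
  · rw [coord_add_long] at h
    have : ((i + 1 : ℕ) : ℝ) ≤ quotient θ (n + 1) := by exact_mod_cast hi
    have : (i + 1 : ℝ) * remainder θ (n + 2) ≤ quotient θ (n + 1) * remainder θ (n + 2) := by
      push_cast at this
      gcongr
    exact h.mono (by linarith)
  · rw [coord_add_long]
    exact h2.mono (by linarith)
  · rw [coord_add_long] at h
    exact h.mono (by linarith)

end Irrational

/-! ### Reading the standard words along the towers. -/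

section Irrational
variable {θ : ℝ} (hθ : Irrational θ) (hθ01 : θ ∈ Set.Ioo (0 : ℝ) 1)

include hθ01 in
lemma letter_eq_zero {x : ℝ} (h0 : 0 ≤ x) (h1 : x < 1 - θ) : letter θ x = 0 := by
  have : Int.fract x = x := Int.fract_eq_self.2 ⟨h0, by linarith [hθ01.1]⟩
  simp only [letter, this]
  rw [if_neg (not_le.2 h1)]

include hθ01 in
lemma letter_eq_one {x : ℝ} (h0 : 1 - θ ≤ x) (h1 : x < 1) : letter θ x = 1 := by
  have : Int.fract x = x := Int.fract_eq_self.2 ⟨by linarith [hθ01.2], h1⟩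
  simp only [letter, this]
  rw [if_pos h0]

lemma factor_sub_intCast (θ x : ℝ) (p : ℤ) (k : ℕ) : factor θ (x - p) k = factor θ x k := by
  simp only [factor]
  refine List.map_congr_left fun i _ => ?_
  rw [← letter_add_intCast θ _ p]
  congr 1
  ring

lemma isLong_zero_iff {x : ℝ} : IsLong θ 0 x ↔ ∃ p : ℤ,
    1 - quotient θ 0 * θ ≤ x - p ∧ x - p < 1 - quotient θ 0 * θ + θ := by
  have hr : remainder θ (0 + 2) = 1 - quotient θ 0 * θ := by
    rw [remainder_add_two]
    simp [remainder]
  simp only [IsLong, IsUpper, coord, hr]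
  refine exists_congr fun p => ?_
  simp only [Even.zero, ↓reduceIte, zero_add, pow_one, remainder, not_lt]
  constructor <;> rintro ⟨h1, h2⟩ <;> constructor <;> linarith

lemma isShort_zero_iff {x : ℝ} : IsShort θ 0 x ↔ ∃ p : ℤ,
    0 ≤ x - p ∧ x - p < 1 - quotient θ 0 * θ := by
  have hr : remainder θ (0 + 2) = 1 - quotient θ 0 * θ := by
    rw [remainder_add_two]
    simp [remainder]
  simp only [IsShort, IsUpper, coord, hr]
  refine exists_congr fun p => ?_
  simp only [Even.zero, ↓reduceIte, zero_add, pow_one, remainder, not_lt]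
  constructor <;> rintro ⟨h1, h2⟩ <;> constructor <;> linarith

include hθ hθ01

lemma factor_level_zero (x : ℝ) :
    (IsLong θ 0 x → factor θ x (denom θ 2) = word θ 2) ∧
    (IsShort θ 0 x → factor θ x (denom θ 1) = word θ 1) := by
  have ha := one_le_quotient hθ hθ01 0
  have ha' : (1 : ℝ) ≤ quotient θ 0 := by exact_mod_cast ha
  have hpos := hθ01.1
  have hr2 : 0 < 1 - quotient θ 0 * θ := by
    have := remainder_pos hθ hθ01 2
    rw [remainder_add_two] at this
    simpa [remainder] using this
  constructor
  · rw [isLong_zero_iff]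
    rintro ⟨p, h1, h2⟩
    have hd : denom θ 2 = (quotient θ 0 - 1) + 1 := by
      simp [denom]
      omega
    rw [← factor_sub_intCast θ x p, hd, factor_add, word]
    congr 1
    · rw [factor, List.eq_replicate_iff]
      refine ⟨by simp, fun b hb => ?_⟩
      obtain ⟨i, hi, rfl⟩ := List.mem_map.1 hb
      rw [List.mem_range] at hi
      have hi' : ((i + 2 : ℕ) : ℝ) ≤ quotient θ 0 := by
        exact_mod_cast (by omega : i + 2 ≤ quotient θ 0)
      push_cast at hi'
      have : (i + 2 : ℝ) * θ ≤ quotient θ 0 * θ := by gcongr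
      apply letter_eq_zero hθ01
      · have : 0 ≤ (i : ℝ) * θ := by positivity
        linarith
      · linarith
    · simp only [factor, List.range_one, List.map_cons, List.map_nil]
      congr 1
      apply letter_eq_one hθ01 <;> push_cast [ha] <;> linarith
  · rw [isShort_zero_iff]
    rintro ⟨p, h1, h2⟩
    rw [← factor_sub_intCast θ x p, denom, word]
    simp only [factor, List.range_one, List.map_cons, List.map_nil]
    congr 1
    have : θ ≤ quotient θ 0 * θ := le_mul_of_one_le_left hpos.le ha'
    apply letter_eq_zero hθ01 <;> push_cast <;> linarith

lemma factor_level (n : ℕ) : ∀ x : ℝ,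
    (IsLong θ n x → factor θ x (denom θ (n + 2)) = word θ (n + 2)) ∧
    (IsShort θ n x → factor θ x (denom θ (n + 1)) = word θ (n + 1)) := by
  induction n with
  | zero => exact factor_level_zero hθ hθ01
  | succ n ih =>
    refine fun x => ⟨fun h => ?_, fun h => (ih x).1 (h.isLong_pred hθ hθ01).1⟩
    obtain ⟨h1, h2⟩ := h.pred hθ hθ01
    have key : ∀ i ≤ quotient θ (n + 1), factor θ x (i * denom θ (n + 2)) =
        (List.replicate i (word θ (n + 2))).flatten := by
      intro i hi
      induction i with
      | zero => simp
      | succ i hind =>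
        rw [add_mul, one_mul, factor_add, hind (by omega), List.replicate_succ',
          List.flatten_append, (ih _).1 (h1 i (by omega))]
        simp
    rw [denom_add_two, factor_add]
    change _ = word θ (n + 3)
    rw [word_add_three]
    congr 1
    · exact key _ le_rfl
    · exact (ih _).2 h2

lemma IsLong.factor_eq {n : ℕ} {x : ℝ} (h : IsLong θ n x) :
    factor θ x (denom θ (n + 2)) = word θ (n + 2) := (factor_level hθ hθ01 n x).1 h

lemma IsShort.factor_eq {n : ℕ} {x : ℝ} (h : IsShort θ n x) :
    factor θ x (denom θ (n + 1)) = word θ (n + 1) := (factor_level hθ hθ01 n x).2 h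

lemma exists_block_zero (x : ℝ) : ∃ r : ℕ,
    (IsLong θ 0 (x - r * θ) ∧ r < denom θ 2) ∨ (IsShort θ 0 (x - r * θ) ∧ r < denom θ 1) := by
  have hpos := hθ01.1
  have h0 := Int.fract_nonneg x
  have h1 := Int.fract_lt_one x
  have hx : x = Int.fract x + ⌊x⌋ := (Int.fract_add_floor x).symm
  by_cases h : Int.fract x < 1 - quotient θ 0 * θ
  · exact ⟨0, .inr ⟨isShort_zero_iff.2 ⟨⌊x⌋, by push_cast; linarith, by push_cast; linarith⟩,
      denom_pos hθ hθ01 0⟩⟩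
  · rw [not_lt] at h
    have hnn : 0 ≤ (Int.fract x - (1 - quotient θ 0 * θ)) / θ := by
      apply div_nonneg <;> linarith
    refine ⟨⌊(Int.fract x - (1 - quotient θ 0 * θ)) / θ⌋₊, .inl ⟨?_, ?_⟩⟩
    · have h2 := Nat.floor_le hnn
      have h3 := Nat.lt_floor_add_one ((Int.fract x - (1 - quotient θ 0 * θ)) / θ)
      rw [le_div_iff₀ hpos] at h2
      rw [div_lt_iff₀ hpos] at h3
      exact isLong_zero_iff.2 ⟨⌊x⌋, by linarith, by linarith⟩
    · rw [Nat.floor_lt hnn, div_lt_iff₀ hpos]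
      simp only [denom]
      push_cast
      linarith

/-- The towers cover the circle. In the level `n` coordinate the next base runs only from -r_{n+2}
to r_{n+3}; a base point beyond it is moved back by multiples of r_{n+2} until it lands in the next
long base. -/
lemma exists_block (n : ℕ) (x : ℝ) : ∃ r : ℕ,
    (IsLong θ n (x - r * θ) ∧ r < denom θ (n + 2)) ∨
    (IsShort θ n (x - r * θ) ∧ r < denom θ (n + 1)) := by
  induction n with
  | zero => exact exists_block_zero hθ hθ01 x
  | succ n ih =>
    obtain ⟨r, ih⟩ := ih
    have hr : remainder θ (n + 3) = remainder θ (n + 1) - _ := remainder_add_two θ (n + 1)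
    rw [show n + 1 + 1 = n + 2 from rfl] at hr
    have hd : denom θ (n + 3) = _ := denom_add_two θ (n + 1)
    rw [show n + 1 + 1 = n + 2 from rfl] at hd
    have ha := one_le_quotient hθ hθ01 (n + 1)
    have hp := remainder_pos hθ hθ01 (n + 2)
    have hlt : remainder θ (n + 2) < remainder θ (n + 1) := remainder_lt hθ hθ01 (n + 1)
    have hlt' : remainder θ (n + 3) < remainder θ (n + 2) := remainder_lt hθ hθ01 (n + 2)
    have hp3 := remainder_pos hθ hθ01 (n + 3)
    have hdle : denom θ (n + 2) ≤ quotient θ (n + 1) * denom θ (n + 2) :=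
      Nat.le_mul_of_pos_left _ ha
    have hlong : ∀ y p, IsUpper n (coord θ n y p + remainder θ (n + 2) - remainder θ (n + 3)) →
        ¬ IsUpper n (coord θ n y p - remainder θ (n + 3)) → IsLong θ (n + 1) y := by
      intro y p h1 h2
      refine ⟨p, ?_, ?_⟩ <;> rw [isUpper_succ, coord_succ]
      · change ¬ IsUpper n (-(- coord θ n y p + remainder θ (n + 3)))
        exact fun h => h2 (h.mono (by linarith))
      · rw [not_not]
        change IsUpper n (-(- coord θ n y p + remainder θ (n + 3) - remainder θ (n + 2)))
        exact h1.mono (by linarith)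
    have hshort : ∀ y p, IsUpper n (coord θ n y p + remainder θ (n + 2)) →
        ¬ IsUpper n (coord θ n y p + remainder θ (n + 2) - remainder θ (n + 3)) →
        IsShort θ (n + 1) y := by
      intro y p h1 h2
      refine ⟨p, ?_, ?_⟩ <;> rw [isUpper_succ, coord_succ]
      · change ¬ IsUpper n (-(- coord θ n y p + remainder θ (n + 3) - remainder θ (n + 2)))
        exact fun h => h2 (h.mono (by linarith))
      · rw [not_not]
        change IsUpper n (-(- coord θ n y p - remainder θ (n + 2)))
        exact h1.mono (by linarith)
    -- a point of a tower over `y` lies in a higher tower over an earlier long block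
    have hback : ∀ p (i : ℕ), IsUpper n (coord θ n (x - r * θ) p - remainder θ (n + 3)) →
        i ≤ quotient θ (n + 1) →
        ¬ IsUpper n (coord θ n (x - r * θ) p - i * remainder θ (n + 2) - remainder θ (n + 3)) →
        ∃ j ≤ i, IsLong θ (n + 1) (x - (r + j * denom θ (n + 2) : ℕ) * θ) := by
      intro p i hup _ hi
      classical
      have hex : ∃ j : ℕ, ¬ IsUpper n
          (coord θ n (x - r * θ) p - j * remainder θ (n + 2) - remainder θ (n + 3)) := ⟨i, hi⟩
      refine ⟨Nat.find hex, Nat.find_min' hex hi, ?_⟩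
      have hs := Nat.find_spec hex
      obtain ⟨k, hk⟩ : ∃ k, Nat.find hex = k + 1 := by
        refine Nat.exists_eq_succ_of_ne_zero fun h0 => ?_
        rw [h0] at hs
        exact hs (hup.mono (by simp))
      have hm := Nat.find_min hex (m := k) (by omega)
      rw [not_not] at hm
      rw [hk] at hs ⊢
      have hc := coord_add_long θ n (x - (r + (k + 1) * denom θ (n + 2) : ℕ) * θ)
        (p - (k + 1 : ℕ) * numer θ (n + 2)) (k + 1)
      rw [sub_add_cancel] at hc
      have he : x - (r + (k + 1) * denom θ (n + 2) : ℕ) * θ +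
          ((k + 1) * denom θ (n + 2) : ℕ) * θ = x - r * θ := by
        push_cast
        ring
      rw [he] at hc
      push_cast at hs hc
      refine hlong _ (p - (k + 1 : ℕ) * numer θ (n + 2)) (hm.mono ?_)
        (fun h => hs (h.mono ?_)) <;> push_cast <;> linarith
    rcases ih with ⟨⟨p, h1, h2⟩, hlt⟩ | ⟨⟨p, h1, h2⟩, hlt⟩
    · by_cases h3 : IsUpper n (coord θ n (x - r * θ) p - remainder θ (n + 3))
      · obtain ⟨j, hj, hl⟩ := hback p (quotient θ (n + 1) - 1) h3 (by omega) (fun h => h2 (h.mono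
          (by push_cast [ha]; linarith)))
        refine ⟨_, .inl ⟨hl, ?_⟩⟩
        have : (j + 1) * denom θ (n + 2) ≤ quotient θ (n + 1) * denom θ (n + 2) :=
          Nat.mul_le_mul_right _ (by omega)
        change _ < denom θ (n + 3)
        rw [hd]
        linarith
      · by_cases h4 : IsUpper n
            (coord θ n (x - r * θ) p + remainder θ (n + 2) - remainder θ (n + 3))
        · refine ⟨r, .inl ⟨hlong _ p h4 h3, ?_⟩⟩
          change _ < denom θ (n + 3)
          omega
        · exact ⟨r, .inr ⟨hshort _ p h1 h4, hlt⟩⟩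
    · by_cases h3 : IsUpper n (coord θ n (x - r * θ) p - remainder θ (n + 3))
      · obtain ⟨j, hj, hl⟩ := hback p (quotient θ (n + 1)) h3 le_rfl (fun h => h2 (h.mono
          (by linarith)))
        refine ⟨_, .inl ⟨hl, ?_⟩⟩
        have : j * denom θ (n + 2) ≤ quotient θ (n + 1) * denom θ (n + 2) :=
          Nat.mul_le_mul_right _ hj
        change _ < denom θ (n + 3)
        rw [hd]
        linarith
      · refine ⟨r, .inl ⟨hlong _ p ?_ h3, ?_⟩⟩
        · have : remainder θ (n + 3) ≤ remainder θ (n + 1) := by linarith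
          exact h1.mono (by linarith)
        · change _ < denom θ (n + 3)
          omega

end Irrational

/-! ### Squares at every point and scale. -/

/-- `x` is the point at position `r` of a block that reads `w w w₁`, where `w₁` consists of the
first `r` letters of `w`. -/
def StartsSquare (θ : ℝ) (w : List ℝ) (x : ℝ) : Prop := ∃ r : ℕ, r ≤ w.length ∧
  factor θ (x - r * θ) (w.length + w.length + r) = w ++ w ++ w.take r

section Irrational
variable {θ : ℝ} (hθ : Irrational θ) (hθ01 : θ ∈ Set.Ioo (0 : ℝ) 1)
include hθ hθ01

lemma word_prefix (n : ℕ) : word θ (n + 2) <+: word θ (n + 3) := by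
  obtain ⟨k, hk⟩ := Nat.exists_eq_add_of_le' (one_le_quotient hθ hθ01 (n + 1))
  rw [word_add_three, hk, List.replicate_succ, List.flatten_cons, List.append_assoc]
  exact List.prefix_append _ _

/-- By near-commutation, what follows a block boundary does not depend on the type of the next
block, up to the last two letters of a long and a short word together. -/
lemma factor_of_isLong_or_isShort {n : ℕ} {x : ℝ} {l : List ℝ} {e f : ℝ}
    (h1 : word θ (n + 3) ++ word θ (n + 2) = l ++ [e, f])
    (h2 : word θ (n + 2) ++ word θ (n + 3) = l ++ [f, e])
    (h : IsLong θ (n + 1) x ∨ IsShort θ (n + 1) x) : factor θ x l.length = l := by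
  rcases h with h | h
  · rcases h.next hθ hθ01 with h' | h'
    · obtain ⟨t, ht⟩ := word_prefix hθ hθ01 n
      have : factor θ x (denom θ (n + 3) + denom θ (n + 3)) = l ++ ([e, f] ++ t) := by
        rw [factor_add, h.factor_eq hθ hθ01, h'.factor_eq hθ hθ01, ← List.append_assoc, ← h1,
          List.append_assoc, ht]
      exact factor_length_of_eq_append this
    · have : factor θ x (denom θ (n + 3) + denom θ (n + 2)) = l ++ [e, f] := by
        rw [factor_add, h.factor_eq hθ hθ01, h'.factor_eq hθ hθ01, ← h1]
      exact factor_length_of_eq_append this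
  · have h' := h.next hθ hθ01
    have : factor θ x (denom θ (n + 2) + denom θ (n + 3)) = l ++ [f, e] := by
      rw [factor_add, h.factor_eq hθ hθ01, h'.factor_eq hθ hθ01, ← h2]
    exact factor_length_of_eq_append this

lemma startsSquare_long_long {n : ℕ} {x : ℝ} {r : ℕ} (hr : r < denom θ (n + 3))
    (h : IsLong θ (n + 1) (x - r * θ))
    (h' : IsLong θ (n + 1) (x - r * θ + denom θ (n + 3) * θ)) :
    StartsSquare θ (word θ (n + 3)) x := by
  obtain ⟨l, e, f, h1, h2⟩ := word_commute θ (n + 1)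
  have hl := factor_of_isLong_or_isShort hθ hθ01 h1 h2 (h'.next hθ hθ01)
  have hlen := congrArg List.length h1
  have hlong : (word θ (n + 3)).length = _ := length_word hθ hθ01 (n + 2)
  have hshort : (word θ (n + 2)).length = _ := length_word hθ hθ01 (n + 1)
  rw [List.length_append, List.length_append, List.length_cons, List.length_cons,
    List.length_nil] at hlen
  change (word θ (n + 3)).length + (word θ (n + 2)).length = _ at hlen
  rw [show n + 1 + 1 = n + 2 from rfl] at hshort
  rw [show n + 2 + 1 = n + 3 from rfl] at hlong
  have hpos : 0 < denom θ (n + 2) := denom_pos hθ hθ01 (n + 1)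
  refine ⟨r, by omega, ?_⟩
  have ht : (word θ (n + 3)).take r = l.take r := by
    have := congrArg (List.take r) h1
    rwa [List.take_append_of_le_length (by change r ≤ (word θ (n + 3)).length; omega),
      List.take_append_of_le_length (by omega)] at this
  rw [hlong, factor_add, factor_add, h.factor_eq hθ hθ01, h'.factor_eq hθ hθ01, ht, ← hl,
    factor_take _ _ (by omega)]
  congr 2
  push_cast
  ring

/-- The blocks read long, short, long, and then the common prefix `l` replaces short·long. As `l`
lacks two letters, `r` must stop two short of the long length. -/
lemma startsSquare_long_short {n : ℕ} {x : ℝ} {r : ℕ} (hr : r + 2 ≤ denom θ (n + 3))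
    (h : IsLong θ (n + 1) (x - r * θ))
    (h' : IsShort θ (n + 1) (x - r * θ + denom θ (n + 3) * θ)) :
    StartsSquare θ (word θ (n + 3) ++ word θ (n + 2)) x := by
  obtain ⟨l, e, f, h1, h2⟩ := word_commute θ (n + 1)
  have h'' := h'.next hθ hθ01
  have hl := factor_of_isLong_or_isShort hθ hθ01 h1 h2 (h''.next hθ hθ01)
  have hlen := congrArg List.length h1
  have hlong : (word θ (n + 3)).length = _ := length_word hθ hθ01 (n + 2)
  have hshort : (word θ (n + 2)).length = _ := length_word hθ hθ01 (n + 1)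
  rw [List.length_append, List.length_append, List.length_cons, List.length_cons,
    List.length_nil] at hlen
  change (word θ (n + 3)).length + (word θ (n + 2)).length = _ at hlen
  rw [show n + 1 + 1 = n + 2 from rfl] at hshort
  rw [show n + 2 + 1 = n + 3 from rfl] at hlong
  refine ⟨r, by rw [List.length_append]; omega, ?_⟩
  have ht : (word θ (n + 2) ++ word θ (n + 3)).take (denom θ (n + 2) + r) =
      l.take (denom θ (n + 2) + r) := by
    change word θ (n + 2) ++ word θ (n + 3) = _ at h2
    rw [h2, List.take_append_of_le_length (by omega)]
  rw [List.take_append, List.take_of_length_le (by omega), hshort, Nat.add_sub_cancel_left] at ht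
  rw [List.take_append_of_le_length (by omega), List.length_append, hlong, hshort,
    show denom θ (n + 3) + denom θ (n + 2) + (denom θ (n + 3) + denom θ (n + 2)) + r =
      denom θ (n + 3) + denom θ (n + 2) + denom θ (n + 3) + (denom θ (n + 2) + r) by ring,
    factor_add, factor_add, factor_add, h.factor_eq hθ hθ01, h'.factor_eq hθ hθ01,
    show x - r * θ + ((denom θ (n + 3) + denom θ (n + 2) : ℕ) : ℝ) * θ =
      x - r * θ + denom θ (n + 3) * θ + denom θ (n + 2) * θ by push_cast; ring,
    h''.factor_eq hθ hθ01]
  simp only [List.append_assoc]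
  congr 3
  rw [ht, ← hl, factor_take _ _ (by omega)]
  congr 1
  push_cast
  ring

/-- Every point is the beginning of a square of each scale. -/
lemma exists_startsSquare (n : ℕ) (x : ℝ) : ∃ w : List ℝ, StartsSquare θ w x ∧
    (w = word θ (n + 3) ∨ w = word θ (n + 4) ∨ w = word θ (n + 5) ∨
      w = word θ (n + 5) ++ word θ (n + 4)) := by
  have short : ∀ (m r : ℕ), IsShort θ (m + 2) (x - r * θ) → r < denom θ (m + 3) →
      StartsSquare θ (word θ (m + 3)) x := by
    intro m r h hr
    obtain ⟨h1, h2⟩ := h.isLong_pred hθ hθ01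
    exact startsSquare_long_long hθ hθ01 hr h1 h2
  obtain ⟨r, ⟨h, hr⟩ | ⟨h, hr⟩⟩ := exists_block hθ hθ01 (n + 3) x
  · rcases h.next hθ hθ01 with h' | h'
    · exact ⟨_, startsSquare_long_long (n := n + 2) hθ hθ01 hr h h', .inr (.inr (.inl rfl))⟩
    · by_cases hr2 : r + 2 ≤ denom θ (n + 5)
      · exact ⟨_, startsSquare_long_short (n := n + 2) hθ hθ01 hr2 h h', .inr (.inr (.inr rfl))⟩
      -- The excluded position is the last letter of the long block. It lies in the short block one
      -- level down that ends it, where `short` gives a square.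
      · change r < denom θ (n + 5) at hr
        have hd : denom θ (n + 5) = _ := denom_add_two θ (n + 3)
        rw [show n + 3 + 1 = n + 4 from rfl] at hd
        have hp : 0 < denom θ (n + 3) := denom_pos hθ hθ01 (n + 2)
        have hr' : r = quotient θ (n + 3) * denom θ (n + 4) + (denom θ (n + 3) - 1) := by omega
        have hs := (IsLong.pred (n := n + 2) hθ hθ01 h).2
        refine ⟨_, short n (denom θ (n + 3) - 1) ?_ (by omega), .inl rfl⟩
        convert hs using 1
        rw [hr']
        push_cast
        ring
  · exact ⟨_, short (n + 1) r h hr, .inr (.inl rfl)⟩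

end Irrational
-- Transfer matrices and the trace map.
open Matrix

/-- The one-step transfer matrix for the letter `c`. -/
def stepMatrix (lam E c : ℝ) : Matrix (Fin 2) (Fin 2) ℝ := !![E - lam * c, -1; 1, 0]

/-- The transfer matrix across a word. -/
def transfer (lam E : ℝ) : List ℝ → Matrix (Fin 2) (Fin 2) ℝ
  | [] => 1
  | c :: w => transfer lam E w * stepMatrix lam E c

lemma transfer_append (lam E : ℝ) (w w' : List ℝ) :
    transfer lam E (w ++ w') = transfer lam E w' * transfer lam E w := by
  induction w with
  | nil => simp [transfer]
  | cons c w ih => simp [transfer, ih, mul_assoc]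

lemma transfer_replicate (lam E : ℝ) (w : List ℝ) (k : ℕ) :
    transfer lam E (List.replicate k w).flatten = transfer lam E w ^ k := by
  induction k with
  | zero => simp [transfer]
  | succ k ih => rw [List.replicate_succ, List.flatten_cons, transfer_append, ih, pow_succ]

lemma transfer_replicate_letter (lam E c : ℝ) (k : ℕ) :
    transfer lam E (List.replicate k c) = stepMatrix lam E c ^ k := by
  induction k with
  | zero => simp [transfer]
  | succ k ih => rw [List.replicate_succ, transfer, ih, pow_succ]

lemma det_transfer (lam E : ℝ) (w : List ℝ) : (transfer lam E w).det = 1 := by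
  induction w with
  | nil => simp [transfer]
  | cons c w ih => simp [transfer, ih, stepMatrix, det_fin_two]

lemma mul_self_eq_of_det_eq_one {R : Type*} [CommRing R] {A : Matrix (Fin 2) (Fin 2) R}
    (h : A.det = 1) : A * A = A.trace • A - 1 := by
  rw [det_fin_two] at h
  ext i j
  fin_cases i <;> fin_cases j <;> simp [mul_apply, trace_fin_two, Fin.sum_univ_two]
  · linear_combination -h
  · ring
  · ring
  · linear_combination -h

/-- The transfer matrices of the standard words, starting with the formal word `s₋₁`. -/
noncomputable def wordMatrix (a : ℕ → ℕ) (lam E : ℝ) : ℕ → Matrix (Fin 2) (Fin 2) ℝ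
  | 0 => !![1, -lam; 0, 1]
  | 1 => stepMatrix lam E 0
  | n + 2 => wordMatrix a lam E n * wordMatrix a lam E (n + 1) ^ a n

section TraceMap
variable (a : ℕ → ℕ) (lam E : ℝ)

lemma wordMatrix_add_two (n : ℕ) : wordMatrix a lam E (n + 2) =
    wordMatrix a lam E n * wordMatrix a lam E (n + 1) ^ a n := by
  rw [wordMatrix]

lemma det_wordMatrix (n : ℕ) : (wordMatrix a lam E n).det = 1 := by
  induction n using Nat.twoStepInduction with
  | zero => simp [wordMatrix, det_fin_two]
  | one => simp [wordMatrix, stepMatrix, det_fin_two]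
  | more n h0 h1 => simp [wordMatrix, h0, h1]

lemma continuous_wordMatrix (n : ℕ) : Continuous fun E => wordMatrix a lam E n := by
  induction n using Nat.twoStepInduction with
  | zero => simp only [wordMatrix]; exact continuous_const
  | one =>
    simp only [wordMatrix, stepMatrix]
    refine continuous_matrix fun i j => ?_
    fin_cases i <;> fin_cases j <;> simp <;> fun_prop
  | more n h0 h1 => simp only [wordMatrix]; exact h0.mul (h1.pow _)

/-- The traces of the mixed products of consecutive standard matrices. -/
noncomputable def mixedTrace (n p : ℕ) : ℝ :=
  (wordMatrix a lam E n * wordMatrix a lam E (n + 1) ^ p).trace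

lemma mixedTrace_zero (n : ℕ) : mixedTrace a lam E n 0 = (wordMatrix a lam E n).trace := by
  simp [mixedTrace]

lemma mixedTrace_quotient (n : ℕ) :
    mixedTrace a lam E n (a n) = (wordMatrix a lam E (n + 2)).trace := by
  rw [mixedTrace, wordMatrix_add_two]

/-- Cyclicity of the trace links two levels; this carries the invariant and the escape condition
upwards. -/
lemma mixedTrace_succ_one (n : ℕ) :
    mixedTrace a lam E (n + 1) 1 = mixedTrace a lam E n (a n + 1) := by
  rw [mixedTrace, mixedTrace, pow_one, wordMatrix_add_two, trace_mul_comm, mul_assoc, ← pow_succ]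

lemma mixedTrace_add_two (n p : ℕ) : mixedTrace a lam E n (p + 2) =
    (wordMatrix a lam E (n + 1)).trace * mixedTrace a lam E n (p + 1) - mixedTrace a lam E n p := by
  simp only [mixedTrace]
  rw [show p + 2 = p + (1 + 1) from rfl, pow_add, pow_add, pow_one, pow_add, pow_one,
    mul_self_eq_of_det_eq_one (det_wordMatrix a lam E (n + 1))]
  simp [mul_sub]

/-- The Fricke–Vogt invariant. -/
lemma mixedTrace_invariant (n p : ℕ) :
    (wordMatrix a lam E (n + 1)).trace ^ 2 + mixedTrace a lam E n p ^ 2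
      + mixedTrace a lam E n (p + 1) ^ 2
      - (wordMatrix a lam E (n + 1)).trace * mixedTrace a lam E n p * mixedTrace a lam E n (p + 1)
      = lam ^ 2 + 4 := by
  induction n generalizing p with
  | zero =>
    induction p with
    | zero =>
      simp [mixedTrace, wordMatrix, stepMatrix, trace_fin_two]
      ring
    | succ p ih => rw [mixedTrace_add_two]; linear_combination ih
  | succ n ihn =>
    induction p with
    | zero =>
      have := ihn (a n)
      rw [mixedTrace_quotient] at this
      rw [zero_add, mixedTrace_zero, mixedTrace_succ_one]
      linear_combination this
    | succ p ih => rw [mixedTrace_add_two]; linear_combination ih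

end TraceMap

/-- The bound for the traces of the standard words at energies in the spectrum. -/
noncomputable def traceBound (lam : ℝ) : ℝ := |lam| + 6

lemma abs_le_traceBound {lam x y z : ℝ} (h : x ^ 2 + y ^ 2 + z ^ 2 - x * y * z = lam ^ 2 + 4)
    (hx : |x| ≤ 2) (hy : |y| ≤ 2) : |z| ≤ traceBound lam := by
  have hxy : |x * y * z| ≤ 4 * |z| := by
    rw [abs_mul, abs_mul]
    have : |x| * |y| ≤ 2 * 2 := mul_le_mul hx hy (abs_nonneg _) (by norm_num)
    nlinarith [abs_nonneg z]
  have h1 := (le_abs_self _).trans hxy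
  rw [← sq_abs z, ← sq_abs lam] at h
  unfold traceBound
  by_contra! hc
  nlinarith [sq_nonneg x, sq_nonneg y, abs_nonneg lam]

lemma abs_lt_abs_of_recurrence {t : ℕ → ℝ} {x : ℝ} (ht : ∀ p, t (p + 2) = x * t (p + 1) - t p)
    (hx : 2 < |x|) {p : ℕ} (h : |t p| < |t (p + 1)|) {q : ℕ} (hpq : p ≤ q) :
    |t q| < |t (q + 1)| := by
  induction q, hpq using Nat.le_induction with
  | base => exact h
  | succ q _ ih =>
    have h1 := abs_sub_abs_le_abs_sub (x * t (q + 1)) (t q)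
    rw [← ht, abs_mul] at h1
    have : 0 ≤ |t q| := abs_nonneg _
    change |t (q + 1)| < |t (q + 2)|
    nlinarith

lemma abs_le_of_recurrence {t : ℕ → ℝ} {p q : ℕ} (h : ∀ r, p ≤ r → |t r| < |t (r + 1)|)
    (hpq : p ≤ q) : |t p| ≤ |t q| := by
  induction q, hpq using Nat.le_induction with
  | base => exact le_rfl
  | succ q hq ih => exact ih.trans (h q hq).le

/-- At the first index with |t| > 2 the sequence has just increased in modulus, and for |x| > 2 an
increase perpetuates itself. -/
lemma exists_crossing {t : ℕ → ℝ} {x : ℝ} (ht : ∀ p, t (p + 2) = x * t (p + 1) - t p)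
    (hx : 2 < |x|) (h0 : |t 0| ≤ 2) {q : ℕ} (hq : 2 < |t q|) : ∃ p < q,
    ∀ r, p ≤ r → |t r| < |t (r + 1)| := by
  classical
  have hex : ∃ k, 2 < |t k| := ⟨q, hq⟩
  obtain ⟨k, hk⟩ : ∃ k, Nat.find hex = k + 1 := by
    refine Nat.exists_eq_succ_of_ne_zero fun h => ?_
    have := Nat.find_spec hex
    rw [h] at this
    linarith
  have h1 := Nat.find_spec hex
  have h2 := Nat.find_min hex (m := k) (by omega)
  rw [hk] at h1
  have h3 := Nat.find_min' hex hq
  exact ⟨k, by omega, fun r hr => abs_lt_abs_of_recurrence ht hx (by linarith) hr⟩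

section TraceMap
variable {a : ℕ → ℕ} (ha : ∀ n, 1 ≤ a n) {lam E : ℝ}

/-- Once this holds, the traces of the standard words stay outside of `[-2, 2]`. -/
def Escapes (a : ℕ → ℕ) (lam E : ℝ) (n : ℕ) : Prop :=
  2 < |(wordMatrix a lam E (n + 1)).trace| ∧ 2 < |mixedTrace a lam E n 1| ∧
    |(wordMatrix a lam E n).trace| < |mixedTrace a lam E n 1|

include ha

lemma abs_trace_lt_of_growth {n p : ℕ} (hx : 2 < |(wordMatrix a lam E (n + 1)).trace|)
    (hp : p < a n)
    (hgrow : ∀ r, p ≤ r → |mixedTrace a lam E n r| < |mixedTrace a lam E n (r + 1)|)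
    (h2 : 2 < |mixedTrace a lam E n (a n)|) : Escapes a lam E (n + 1) := by
  obtain ⟨k, hk⟩ := Nat.exists_eq_add_of_le' (ha n)
  have h3 := hgrow _ hp.le
  have h4 := hgrow k (by omega)
  have h5 := mixedTrace_add_two a lam E n k
  have h6 := abs_sub_abs_le_abs_sub
    ((wordMatrix a lam E (n + 1)).trace * mixedTrace a lam E n (k + 1)) (mixedTrace a lam E n k)
  rw [← h5, abs_mul] at h6
  rw [Escapes, mixedTrace_succ_one, ← mixedTrace_quotient]
  refine ⟨h2, h2.trans h3, ?_⟩
  rw [hk] at h2 h3 ⊢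
  change _ < |mixedTrace a lam E n (k + 2)|
  nlinarith

lemma Escapes.succ {n : ℕ} (h : Escapes a lam E n) : Escapes a lam E (n + 1) := by
  obtain ⟨h1, h2, h3⟩ := h
  rw [← mixedTrace_zero] at h3
  have hgrow : ∀ r, 0 ≤ r → |mixedTrace a lam E n r| < |mixedTrace a lam E n (r + 1)| :=
    fun r hr => abs_lt_abs_of_recurrence (mixedTrace_add_two a lam E n) h1 h3 hr
  exact abs_trace_lt_of_growth ha h1 (ha n) hgrow
    (h2.trans_le (abs_le_of_recurrence (fun r _ => hgrow r (Nat.zero_le _)) (ha n)))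

lemma Escapes.two_lt {n : ℕ} (h : Escapes a lam E n) {m : ℕ} (hm : n ≤ m) :
    2 < |(wordMatrix a lam E (m + 1)).trace| := by
  have : Escapes a lam E m := by
    induction m, hm using Nat.le_induction with
    | base => exact h
    | succ m _ ih => exact ih.succ ha
  exact this.1

variable (hesc : ∀ n, ¬ Escapes a lam E n)
include hesc

/-- Of two consecutive traces one is bounded by 2: the first pair outside [-2, 2] would be reached
through a crossing, hence escape. The induction starts since the formal matrix has trace 2. -/
lemma abs_trace_le_or (n : ℕ) :
    |(wordMatrix a lam E n).trace| ≤ 2 ∨ |(wordMatrix a lam E (n + 1)).trace| ≤ 2 := by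
  induction n with
  | zero => left; simp [wordMatrix, trace_fin_two]; norm_num
  | succ n ih =>
    by_contra! hc
    obtain ⟨h1, h2⟩ := hc
    have h0 := ih.resolve_right (not_le.2 h1)
    rw [← mixedTrace_zero] at h0
    change 2 < |(wordMatrix a lam E (n + 2)).trace| at h2
    rw [← mixedTrace_quotient] at h2
    obtain ⟨p, hp, hgrow⟩ := exists_crossing (mixedTrace_add_two a lam E n) h1 h0 h2
    exact hesc _ (abs_trace_lt_of_growth ha h1 hp hgrow h2)

/-- At p = 0 and p = `a n` the mixed trace is that of a neighbouring standard word, hence at most 2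
in modulus. An excursion in between could not return. -/
lemma abs_mixedTrace_le_two {n p : ℕ} (hx : 2 < |(wordMatrix a lam E (n + 1)).trace|)
    (hp : p ≤ a n) : |mixedTrace a lam E n p| ≤ 2 := by
  by_contra! hc
  have h0 := (abs_trace_le_or ha hesc n).resolve_right (not_le.2 hx)
  have h2 := (abs_trace_le_or ha hesc (n + 1)).resolve_left (not_le.2 hx)
  change |(wordMatrix a lam E (n + 2)).trace| ≤ 2 at h2
  rw [← mixedTrace_zero] at h0
  rw [← mixedTrace_quotient] at h2
  obtain ⟨q, hq, hgrow⟩ := exists_crossing (mixedTrace_add_two a lam E n) hx h0 hc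
  have := abs_le_of_recurrence (fun r hr => hgrow r (hq.le.trans hr)) hp
  linarith

lemma abs_trace_le (n : ℕ) : |(wordMatrix a lam E n).trace| ≤ traceBound lam := by
  have hb : 2 ≤ traceBound lam := by unfold traceBound; linarith [abs_nonneg lam]
  cases n with
  | zero =>
    refine le_trans ?_ hb
    simp [wordMatrix, trace_fin_two]
    norm_num
  | succ n =>
    by_cases hx : 2 < |(wordMatrix a lam E (n + 1)).trace|
    · refine abs_le_traceBound ?_ (abs_mixedTrace_le_two ha hesc hx (Nat.zero_le _))
        (abs_mixedTrace_le_two ha hesc hx (ha n))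
      linear_combination mixedTrace_invariant a lam E n 0
    · linarith

/-- Controls the product of two consecutive words. If the earlier trace is large, the quantity is
the mixed trace one level down just past its controlled range, so one recurrence step suffices. -/
lemma abs_mixedTrace_one_le (n : ℕ) : |mixedTrace a lam E n 1| ≤ 2 * traceBound lam + 2 := by
  have hb : 2 ≤ traceBound lam := by unfold traceBound; linarith [abs_nonneg lam]
  by_cases hx : 2 < |(wordMatrix a lam E (n + 1)).trace|
  · have := abs_mixedTrace_le_two ha hesc hx (ha n)
    linarith
  by_cases hy : 2 < |(wordMatrix a lam E n).trace|
  · cases n with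
    | zero =>
      simp [wordMatrix, trace_fin_two] at hy
      norm_num at hy
    | succ n =>
      obtain ⟨k, hk⟩ := Nat.exists_eq_add_of_le' (ha n)
      have h1 := abs_mixedTrace_le_two ha hesc hy (p := k) (by omega)
      have h2 := abs_mixedTrace_le_two ha hesc hy (p := k + 1) (by omega)
      have h3 := abs_trace_le ha hesc (n + 1)
      rw [mixedTrace_succ_one, hk]
      change |mixedTrace a lam E n (k + 2)| ≤ _
      rw [mixedTrace_add_two]
      refine (abs_sub _ _).trans ?_
      rw [abs_mul]
      have := mul_le_mul h3 h2 (abs_nonneg _) (by linarith)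
      linarith
  · have := abs_le_traceBound (mixedTrace_invariant a lam E n 0) (not_lt.1 hx)
      (by rw [mixedTrace_zero]; exact not_lt.1 hy)
    rw [zero_add] at this
    linarith

end TraceMap

lemma transfer_word {θ : ℝ} (hθ : Irrational θ) (hθ01 : θ ∈ Set.Ioo (0 : ℝ) 1) (lam E : ℝ)
    (n : ℕ) : transfer lam E (word θ (n + 1)) = wordMatrix (quotient θ) lam E (n + 1) := by
  induction n using Nat.twoStepInduction with
  | zero => simp [word, transfer, wordMatrix]
  | one =>
    obtain ⟨k, hk⟩ := Nat.exists_eq_add_of_le' (one_le_quotient hθ hθ01 0)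
    have : stepMatrix lam E 1 = !![1, -lam; 0, 1] * stepMatrix lam E 0 := by
      simp [stepMatrix, sub_eq_add_neg]
    rw [wordMatrix_add_two, word, transfer_append, transfer_replicate_letter, hk,
      Nat.add_sub_cancel, pow_succ', ← mul_assoc]
    simp only [wordMatrix, transfer, one_mul, this]
  | more n h0 h1 =>
    rw [word_add_three, transfer_append, transfer_replicate, h0, h1,
      ← wordMatrix_add_two _ _ _ (n + 1)]

/-! ### Solutions, squares and periodicity. -/

/-- The pair of consecutive values of a sequence. -/
def state (u : ℤ → ℂ) (n : ℤ) : Fin 2 → ℂ := ![u n, u (n - 1)]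

/-- The word that a potential spells on `[j, j + k)`. -/
noncomputable def windowWord (V : ℤ → ℝ) (j : ℤ) (k : ℕ) : List ℝ :=
  (List.range k).map fun i : ℕ => V (j + i)

lemma windowWord_succ (V : ℤ → ℝ) (j : ℤ) (k : ℕ) :
    windowWord V j (k + 1) = windowWord V j k ++ [V (j + k)] := by
  simp [windowWord, List.range_succ]

lemma windowWord_potential (θ β : ℝ) (j : ℤ) (k : ℕ) :
    windowWord (potential θ β) j k = factor θ (j * θ + β) k := by
  refine List.map_congr_left fun i _ => ?_
  rw [potential_eq_letter]
  congr 1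
  push_cast
  ring

lemma state_add {lam E : ℝ} {V : ℤ → ℝ} {u : ℤ → ℂ}
    (hu : ∀ n, u (n + 1) + u (n - 1) + ((lam * V n : ℝ) : ℂ) * u n = (E : ℂ) * u n)
    (j : ℤ) (k : ℕ) : state u (j + k) =
      ((transfer lam E (windowWord V j k)).map Complex.ofRealHom) *ᵥ state u j := by
  induction k with
  | zero => simp [windowWord, transfer]
  | succ k ih =>
    rw [windowWord_succ, transfer_append, Matrix.map_mul, ← mulVec_mulVec, ← ih]
    have h := hu (j + k)
    ext i
    fin_cases i
    · simp [state, transfer, stepMatrix, mulVec, dotProduct, Fin.sum_univ_two]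
      rw [← add_assoc]
      push_cast at h
      linear_combination h
    · simp [state, transfer, stepMatrix, mulVec, dotProduct, Fin.sum_univ_two]
      congr 1
      ring

lemma StartsSquare.recurrence {θ β lam E : ℝ} {w : List ℝ} {j : ℤ} {u : ℤ → ℂ}
    (hu : IsSolution lam θ β E u) (h : StartsSquare θ w (j * θ + β)) :
    u (j + w.length + w.length) - ((transfer lam E w).trace : ℂ) * u (j + w.length) + u j = 0 := by
  obtain ⟨r, hr, hw⟩ := h
  have h1 : factor θ (j * θ + β - r * θ) r = w.take r := by
    rw [← factor_take θ _ (show r ≤ w.length + w.length + r by omega), hw, List.append_assoc,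
      List.take_append_of_le_length hr]
  have h2 : factor θ (j * θ + β - r * θ) (w.length + r) = w ++ w.take r := by
    rw [← factor_take θ _ (show w.length + r ≤ w.length + w.length + r by omega), hw,
      List.append_assoc, List.take_length_add_append, List.take_append_of_le_length hr]
  have hx : (j : ℝ) * θ + β - r * θ = ((j - r : ℤ) : ℝ) * θ + β := by
    push_cast
    ring
  rw [hx, ← windowWord_potential] at h1 h2 hw
  have s1 := state_add hu (j - r) r
  have s2 := state_add hu (j - r) (w.length + r)
  have s3 := state_add hu (j - r) (w.length + w.length + r)
  rw [h1] at s1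
  rw [h2, transfer_append, Matrix.map_mul] at s2
  rw [hw, transfer_append, transfer_append, mul_self_eq_of_det_eq_one (det_transfer _ _ _),
    Matrix.map_mul, Matrix.map_sub _ (by simp),
    Matrix.map_one _ (by simp) (by simp)] at s3
  have hm : ((transfer lam E w).trace • transfer lam E w).map Complex.ofRealHom =
      ((transfer lam E w).trace : ℂ) • (transfer lam E w).map Complex.ofRealHom := by
    ext
    simp
  rw [hm, mul_sub, mul_one, sub_mulVec, ← s1, mul_smul_comm, smul_mulVec, ← s2] at s3
  have := congrFun s3 0
  simp only [state, cons_val_zero, Pi.sub_apply, Pi.smul_apply, smul_eq_mul] at this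
  rw [show j - r + (r : ℤ) = j by ring, show j - r + ((w.length + r : ℕ) : ℤ) = j + w.length by
    push_cast; ring, show j - r + ((w.length + w.length + r : ℕ) : ℤ) = j + w.length + w.length by
    push_cast; ring] at this
  rw [this]
  ring

/-- Periodicity makes 1 an eigenvalue of a matrix of determinant one. -/
lemma trace_eq_two_of_periodic {lam E : ℝ} {V : ℤ → ℝ} {u : ℤ → ℂ}
    (hu : ∀ n, u (n + 1) + u (n - 1) + ((lam * V n : ℝ) : ℂ) * u n = (E : ℂ) * u n)
    {q : ℕ} (hper : ∀ n, u (n + q) = u n) (h0 : state u 0 ≠ 0) :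
    (transfer lam E (windowWord V 0 q)).trace = 2 := by
  have hs := state_add hu 0 q
  have he : state u (0 + q) = state u 0 := by
    simp only [state]
    rw [hper, show (0 : ℤ) + q - 1 = (0 - 1) + q by ring, hper]
  rw [he] at hs
  set M := transfer lam E (windowWord V 0 q) with hM
  have hdet : (M.map Complex.ofRealHom - 1).det = 0 := by
    rw [← exists_mulVec_eq_zero_iff]
    exact ⟨state u 0, h0, by rw [sub_mulVec, ← hs, one_mulVec, sub_self]⟩
  have hd := det_transfer lam E (windowWord V 0 q)
  rw [← hM, det_fin_two] at hd
  rw [det_fin_two] at hdet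
  simp only [Matrix.sub_apply, map_apply, one_apply_eq, Complex.ofRealHom_eq_coe, ne_eq, zero_ne_one,
    one_ne_zero, not_false_eq_true, one_apply_ne, sub_zero] at hdet
  have hdet' : (M 0 0 - 1) * (M 1 1 - 1) - M 0 1 * M 1 0 = 0 := by exact_mod_cast hdet
  rw [trace_fin_two]
  linarith

lemma eq_zero_of_state_eq_zero {lam E : ℝ} {V : ℤ → ℝ} {u : ℤ → ℂ}
    (hu : ∀ n, u (n + 1) + u (n - 1) + ((lam * V n : ℝ) : ℂ) * u n = (E : ℂ) * u n)
    (h0 : state u 0 = 0) (k : ℕ) : u k = 0 := by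
  have := state_add hu 0 k
  rw [h0, mulVec_zero] at this
  simpa [state] using congrFun this 0

/-! ### Approximate eigenvectors and the spectrum. -/

section Hilbert
variable {F : Type*} [NormedAddCommGroup F] [InnerProductSpace ℂ F]

lemma exists_eigenvector_near [FiniteDimensional ℂ F] {T : F →ₗ[ℂ] F} (hT : T.IsSymmetric)
    {f : F} {E ε : ℝ} (hε : 0 ≤ ε) (h : ‖T f - (E : ℂ) • f‖ < ε * ‖f‖) :
    ∃ (E' : ℝ) (g : F), |E' - E| < ε ∧ g ≠ 0 ∧ T g = (E' : ℂ) • g := by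
  set b := hT.eigenvectorBasis rfl
  by_contra! hc
  have hge : ∀ i, ε ≤ |hT.eigenvalues rfl i - E| := by
    intro i
    by_contra! hi
    refine hc _ (b i) hi (b.orthonormal.ne_zero i) ?_
    simp [b]
  have hsq : (ε * ‖f‖) ^ 2 ≤ ‖T f - (E : ℂ) • f‖ ^ 2 := by
    rw [← b.repr.norm_map (T f - _), ← b.repr.norm_map f, mul_pow, EuclideanSpace.norm_sq_eq,
      EuclideanSpace.norm_sq_eq, Finset.mul_sum]
    refine Finset.sum_le_sum fun i _ => ?_
    have : b.repr (T f - (E : ℂ) • f) i = ((hT.eigenvalues rfl i - E : ℝ) : ℂ) * b.repr f i := by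
      rw [map_sub, map_smul]
      have : b.repr (T f) i = (hT.eigenvalues rfl i : ℂ) * b.repr f i :=
        hT.eigenvectorBasis_apply_self_apply rfl f i
      simp only [PiLp.sub_apply, PiLp.smul_apply, smul_eq_mul]
      rw [this]
      push_cast
      ring
    rw [this, norm_mul, mul_pow, Complex.norm_real, Real.norm_eq_abs]
    have := hge i
    gcongr
  have := pow_lt_pow_left₀ h (norm_nonneg _) two_ne_zero
  linarith

lemma isUnit_of_bounded_below [CompleteSpace F] {A : F →L[ℂ] F} (hA : IsSelfAdjoint A) {ε : ℝ}
    (hε : 0 < ε) (h : ∀ x, ε * ‖x‖ ≤ ‖A x‖) : IsUnit A := by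
  have hanti : AntilipschitzWith (Real.toNNReal ε⁻¹) A := by
    refine A.antilipschitz_of_bound fun x => ?_
    rw [Real.coe_toNNReal _ (by positivity), inv_mul_eq_div, le_div_iff₀ hε, mul_comm]
    exact h x
  rw [ContinuousLinearMap.isUnit_iff_bijective]
  refine ⟨hanti.injective, LinearMap.range_eq_top.1 ?_⟩
  have hcl : IsClosed (A.range : Set F) := by
    have := hanti.isClosed_range A.uniformContinuous
    rwa [← ContinuousLinearMap.coe_coe, ← LinearMap.coe_range] at this
  have hbot : A.rangeᗮ = ⊥ := by
    rw [ContinuousLinearMap.orthogonal_range, hA.adjoint_eq]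
    exact LinearMap.ker_eq_bot.2 hanti.injective
  have htop := (Submodule.topologicalClosure_eq_top_iff (K := A.range)).2 hbot
  rwa [hcl.submodule_topologicalClosure_eq] at htop

end Hilbert

lemma shift_apply (k : ℤ) (u : ellTwo) (n : ℤ) : shift k u n = u (n + k) := rfl

lemma inner_shift (k : ℤ) (u v : ellTwo) :
    inner ℂ (shift k u) v = inner ℂ u (shift (-k) v) := by
  have : v = shift k (shift (-k) v) := by
    ext n
    rw [shift_apply, shift_apply]
    simp
  conv_lhs => rw [this]
  exact (shift k).inner_map_map _ _

lemma mulPotential_apply (θ β : ℝ) (u : ellTwo) (n : ℤ) :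
    mulPotential θ β u n = (potential θ β n : ℂ) * u n := rfl

lemma inner_mulPotential (θ β : ℝ) (u v : ellTwo) :
    inner ℂ (mulPotential θ β u) v = inner ℂ u (mulPotential θ β v) := by
  rw [lp.inner_eq_tsum, lp.inner_eq_tsum]
  refine tsum_congr fun n => ?_
  rw [mulPotential_apply, mulPotential_apply]
  simp only [RCLike.inner_apply, map_mul, Complex.conj_ofReal]
  ring

lemma isSelfAdjoint_hamiltonian (lam θ β : ℝ) : IsSelfAdjoint (hamiltonian lam θ β) := by
  rw [ContinuousLinearMap.isSelfAdjoint_iff_isSymmetric]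
  intro u v
  change inner ℂ (shift 1 u + shift (-1) u + (lam : ℂ) • mulPotential θ β u) v =
    inner ℂ u (shift 1 v + shift (-1) v + (lam : ℂ) • mulPotential θ β v)
  simp only [inner_add_left, inner_add_right, inner_smul_left, inner_smul_right, inner_shift,
    inner_mulPotential, neg_neg, Complex.conj_ofReal]
  ring

lemma exists_approx_eigenvector {lam θ β E : ℝ}
    (hE : (E : ℂ) ∈ spectrum ℂ (hamiltonian lam θ β)) {ε : ℝ} (hε : 0 < ε) :
    ∃ f : ellTwo, ‖hamiltonian lam θ β f - (E : ℂ) • f‖ < ε * ‖f‖ := by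
  by_contra! hc
  refine hE ?_
  rw [spectrum.mem_resolventSet_iff, ← neg_sub, IsUnit.neg_iff]
  refine isUnit_of_bounded_below (ε := ε) ?_ hε fun x => ?_
  · refine (isSelfAdjoint_hamiltonian lam θ β).sub ?_
    rw [Algebra.algebraMap_eq_smul_one]
    exact IsSelfAdjoint.smul (by simp [isSelfAdjoint_iff]) (IsSelfAdjoint.one _)
  · rw [Algebra.algebraMap_eq_smul_one]
    exact hc x

/-- The strict residual inequality is an open condition, so it survives truncation to a large finite
set. -/
lemma exists_finite_approx_eigenvector {lam θ β E : ℝ}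
    (hE : (E : ℂ) ∈ spectrum ℂ (hamiltonian lam θ β)) {ε : ℝ} (hε : 0 < ε) :
    ∃ (f : ellTwo) (N : ℕ), ‖hamiltonian lam θ β f - (E : ℂ) • f‖ < ε * ‖f‖ ∧
      ∀ n : ℤ, N < |n| → f n = 0 := by
  obtain ⟨f, hf⟩ := exists_approx_eigenvector hE hε
  have hs := lp.hasSum_single (p := 2) (by norm_num) f
  have hopen : IsOpen {f : ellTwo | ‖hamiltonian lam θ β f - (E : ℂ) • f‖ < ε * ‖f‖} :=
    isOpen_lt (by fun_prop) (by fun_prop)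
  obtain ⟨s, hs⟩ := (hs.eventually (hopen.mem_nhds hf)).exists
  refine ⟨_, s.sup Int.natAbs, hs, fun n hn => ?_⟩
  rw [lp.coeFn_sum, Finset.sum_apply]
  refine Finset.sum_eq_zero fun i hi => lp.single_apply_ne _ _ _ ?_
  rintro rfl
  have := Finset.le_sup (f := Int.natAbs) hi
  rw [Int.abs_eq_natAbs] at hn
  omega

lemma norm_sq_eq_tsum (f : ellTwo) : ‖f‖ ^ 2 = ∑' n, ‖f n‖ ^ 2 := by
  have := lp.norm_rpow_eq_tsum (p := 2) (by norm_num) f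
  simpa using this

lemma summable_norm_sq (f : ellTwo) : Summable fun n => ‖f n‖ ^ 2 := by
  have := (lp.memℓp f).summable (by norm_num)
  simpa using this

/-! ### Transplantation to a finite cycle. -/

/-- The Schrödinger operator on a cycle of length `q`. -/
noncomputable def cyclicOperator (q : ℕ) (V : ZMod q → ℝ) :
    EuclideanSpace ℂ (ZMod q) →ₗ[ℂ] EuclideanSpace ℂ (ZMod q) where
  toFun f := WithLp.toLp 2 fun i => f (i + 1) + f (i - 1) + (V i : ℂ) * f i
  map_add' f g := by
    ext i
    simp
    ring
  map_smul' c f := by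
    ext i
    simp
    ring

lemma cyclicOperator_apply (q : ℕ) (V : ZMod q → ℝ) (f : EuclideanSpace ℂ (ZMod q)) (i : ZMod q) :
    cyclicOperator q V f i = f (i + 1) + f (i - 1) + (V i : ℂ) * f i := rfl

lemma cyclicOperator_isSymmetric (q : ℕ) [NeZero q] (V : ZMod q → ℝ) :
    (cyclicOperator q V).IsSymmetric := by
  intro f g
  simp only [PiLp.inner_apply, cyclicOperator_apply, RCLike.inner_apply, map_add, map_mul,
    Complex.conj_ofReal, mul_add, add_mul, Finset.sum_add_distrib]
  have h1 : ∑ i, g i * (starRingEnd ℂ) (f (i + 1)) = ∑ i, g (i - 1) * (starRingEnd ℂ) (f i) :=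
    Fintype.sum_equiv (Equiv.addRight 1) _ _ fun i => by simp
  have h2 : ∑ i, g i * (starRingEnd ℂ) (f (i - 1)) = ∑ i, g (i + 1) * (starRingEnd ℂ) (f i) :=
    Fintype.sum_equiv (Equiv.subRight 1) _ _ fun i => by simp
  rw [h1, h2, add_comm (∑ i, g (i - 1) * _)]
  congr 1
  exact Finset.sum_congr rfl fun i _ => by ring

/-- An approximate eigenvector supported in a window where the potential is a piece of a word
yields an energy nearby at which the word has a transfer matrix of trace two. -/
lemma exists_trace_eq_two {lam θ β E ε : ℝ} (hε : 0 < ε) {f : ellTwo} {N : ℕ}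
    (hf : ‖hamiltonian lam θ β f - (E : ℂ) • f‖ < ε * ‖f‖) (hN : ∀ n : ℤ, N < |n| → f n = 0)
    {W : ℕ → ℝ} {q k : ℕ} (hk : N + 2 ≤ k) (hq : k + N + 2 ≤ q)
    (hW : ∀ l : ℕ, |(l : ℤ) - k| ≤ N → W l = potential θ β (l - k)) :
    ∃ E' : ℝ, |E' - E| < ε ∧ (transfer lam E' ((List.range q).map W)).trace = 2 := by
  have : NeZero q := ⟨by omega⟩
  set F : EuclideanSpace ℂ (ZMod q) := WithLp.toLp 2 fun i => f (i.val - k) with hF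
  set T := cyclicOperator q fun i => lam * W i.val with hT
  -- The range includes -1 and q, the neighbours across the seam. The margins in `hk` and `hq` make
  -- `f` vanish there, so wrapping around does no harm.
  have hval : ∀ l : ℤ, -1 ≤ l → l ≤ q → F (l : ZMod q) = f (l - k) := by
    intro l h1 h2
    change f (((l : ZMod q).val : ℤ) - k) = _
    rw [ZMod.val_intCast]
    rcases h1.eq_or_lt with rfl | h1
    · have : (-1 : ℤ) % q = q - 1 := by
        rw [← Int.add_emod_right, Int.emod_eq_of_lt] <;> omega
      rw [this, hN _ (by rw [lt_abs]; omega), hN _ (by rw [lt_abs]; omega)]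
    · rcases h2.eq_or_lt with rfl | h2
      · rw [Int.emod_self, hN _ (by rw [lt_abs]; omega), hN _ (by rw [lt_abs]; omega)]
      · rw [Int.emod_eq_of_lt (by omega) h2]
  have hdiff : ∀ i : ZMod q, (T F - (E : ℂ) • F) i =
      (hamiltonian lam θ β f - (E : ℂ) • f) (i.val - k) := by
    intro i
    have hlt := i.val_lt
    have hi : ((i.val : ℤ) : ZMod q) = i := by simp
    have e1 := hval (i.val + 1) (by omega) (by omega)
    have e2 := hval (i.val - 1) (by omega) (by omega)
    have e3 := hval i.val (by omega) (by omega)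
    rw [Int.cast_add, hi, Int.cast_one] at e1
    rw [Int.cast_sub, hi, Int.cast_one] at e2
    rw [hi] at e3
    have hr : (hamiltonian lam θ β f - (E : ℂ) • f) (i.val - k) =
        action lam θ β f (i.val - k) - E * f (i.val - k) := by
      rw [← hamiltonian_apply]
      rfl
    rw [hr, PiLp.sub_apply, PiLp.smul_apply, hT, cyclicOperator_apply, e1, e2, e3, action,
      smul_eq_mul]
    rw [show (i.val : ℤ) + 1 - k = i.val - k + 1 by ring,
      show (i.val : ℤ) - 1 - k = i.val - k - 1 by ring]
    by_cases h : |(i.val : ℤ) - k| ≤ N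
    · rw [hW _ h]
    · rw [hN _ (not_le.1 h)]
      simp
  have hinj : Function.Injective fun i : ZMod q => (i.val : ℤ) - k := by
    intro i j hij
    apply ZMod.val_injective q
    simp only at hij
    omega
  have hnormF : ‖F‖ ^ 2 = ‖f‖ ^ 2 := by
    rw [EuclideanSpace.norm_sq_eq, norm_sq_eq_tsum, ← tsum_fintype (L := SummationFilter.unconditional _)]
    refine hinj.tsum_eq (f := fun n => ‖f n‖ ^ 2) fun n hn => ?_
    have hn' : |n| ≤ N := by
      by_contra! h
      exact hn (by simp [hN n h])
    rw [abs_le] at hn'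
    refine ⟨((n + k : ℤ) : ZMod q), ?_⟩
    simp only [ZMod.val_intCast]
    rw [Int.emod_eq_of_lt] <;> omega
  have hnormT : ‖T F - (E : ℂ) • F‖ ^ 2 ≤ ‖hamiltonian lam θ β f - (E : ℂ) • f‖ ^ 2 := by
    rw [EuclideanSpace.norm_sq_eq, norm_sq_eq_tsum, ← tsum_fintype (L := SummationFilter.unconditional _)]
    simp only [hdiff]
    exact tsum_comp_le_tsum_of_inj (summable_norm_sq _) (fun _ => sq_nonneg _) hinj
  have hlt : ‖T F - (E : ℂ) • F‖ < ε * ‖F‖ := by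
    rw [sq_eq_sq₀ (norm_nonneg _) (norm_nonneg _)] at hnormF
    rw [hnormF]
    exact ((sq_le_sq₀ (norm_nonneg _) (norm_nonneg _)).1 hnormT).trans_lt hf
  obtain ⟨E', g, hE', hg, hTg⟩ :=
    exists_eigenvector_near (cyclicOperator_isSymmetric q _) hε.le hlt
  refine ⟨E', hE', ?_⟩
  set u : ℤ → ℂ := fun n => g (n : ZMod q) with hu
  have hsol : ∀ n, u (n + 1) + u (n - 1) + ((lam * W ((n : ZMod q).val) : ℝ) : ℂ) * u n
      = (E' : ℂ) * u n := by
    intro n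
    have := congrFun (congrArg (fun x : EuclideanSpace ℂ (ZMod q) => x.ofLp) hTg) (n : ZMod q)
    simpa [hu, cyclicOperator_apply] using this
  have htr := trace_eq_two_of_periodic (V := fun n : ℤ => W ((n : ZMod q).val)) hsol (q := q)
    (fun n => by simp [hu]) (fun h0 => hg ?_)
  · rw [← htr]
    congr 2
    refine List.map_congr_left fun i hi => ?_
    rw [List.mem_range] at hi
    simp [ZMod.val_cast_of_lt hi]
  · ext i
    have := eq_zero_of_state_eq_zero (V := fun n : ℤ => W ((n : ZMod q).val)) hsol h0 i.val
    simpa [hu] using this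

/-! ### Energies in the spectrum do not escape. -/

open Filter Topology

section Irrational
variable {θ : ℝ} (hθ : Irrational θ) (hθ01 : θ ∈ Set.Ioo (0 : ℝ) 1)
include hθ01

lemma eventually_letter_add (x : ℝ) : ∀ᶠ t in 𝓝[≥] (0 : ℝ), letter θ (x + t) = letter θ x := by
  have h0 := Int.fract_nonneg x
  have h1 := Int.fract_lt_one x
  have hl : ∀ t, letter θ (x + t) = letter θ (Int.fract x + t) := by
    intro t
    rw [← letter_add_intCast θ (Int.fract x + t) ⌊x⌋]
    congr 1
    linarith [Int.fract_add_floor x]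
  have hl0 := hl 0
  rw [add_zero, add_zero] at hl0
  by_cases h : Int.fract x < 1 - θ
  · filter_upwards [Ico_mem_nhdsGE (sub_pos.2 h)] with t ht
    rw [hl, hl0, letter_eq_zero hθ01 h0 h,
      letter_eq_zero hθ01 (by linarith [ht.1]) (by linarith [ht.2])]
  · rw [not_lt] at h
    filter_upwards [Ico_mem_nhdsGE (sub_pos.2 h1)] with t ht
    rw [hl, hl0, letter_eq_one hθ01 h h1,
      letter_eq_one hθ01 (by linarith [ht.1]) (by linarith [ht.2])]

include hθ

lemma remainder_two_mul_le (n : ℕ) : remainder θ (2 * n) ≤ (1 / 2) ^ n := by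
  induction n with
  | zero => simp [remainder]
  | succ n ih =>
    have h1 := remainder_add_two θ (2 * n)
    have h2 : remainder θ (2 * n + 2) < remainder θ (2 * n + 1) := remainder_lt hθ hθ01 (2 * n + 1)
    have h3 : remainder θ (2 * n + 1) ≤ quotient θ (2 * n) * remainder θ (2 * n + 1) :=
      le_mul_of_one_le_left (remainder_pos hθ hθ01 _).le
        (by exact_mod_cast one_le_quotient hθ hθ01 _)
    rw [show 2 * (n + 1) = 2 * n + 2 by ring, pow_succ]
    linarith

lemma exists_multiple_near (x : ℝ) (n : ℕ) : ∃ (r : ℕ) (p : ℤ),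
    |x - (r + 1) * θ - p| ≤ remainder θ (n + 1) := by
  have hlt : remainder θ (n + 2) < remainder θ (n + 1) := remainder_lt hθ hθ01 (n + 1)
  have hpos := remainder_pos hθ hθ01 (n + 2)
  have hnot : ∀ t, ¬ IsUpper n t → t ≤ 0 := fun t ht => by
    by_contra! h
    exact ht (IsUpper.of_pos h)
  have habs : ∀ (r : ℕ) (p : ℤ), |coord θ n (x - r * θ) p| = |x - (r + 1) * θ - p| := by
    intro r p
    rw [coord, abs_mul, abs_pow, abs_neg, abs_one, one_pow, one_mul]
    congr 1
    ring
  obtain ⟨r, ⟨⟨p, h1, h2⟩, _⟩ | ⟨⟨p, h1, h2⟩, _⟩⟩ := exists_block hθ hθ01 n x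
  all_goals
    have h1' := h1.nonneg
    have h2' := hnot _ h2
    refine ⟨r, p, ?_⟩
    rw [← habs, abs_le]
    constructor <;> linarith

lemma exists_multiple_right (x : ℝ) {δ : ℝ} (hδ : 0 < δ) (K : ℕ) : ∃ (k : ℕ) (p : ℤ), K ≤ k ∧
    (k + 1) * θ - p - x ∈ Set.Ico 0 δ := by
  obtain ⟨n, hn⟩ := exists_pow_lt_of_lt_one (half_pos hδ) (by norm_num : (1 / 2 : ℝ) < 1)
  have hr := (remainder_lt hθ hθ01 (2 * n)).trans_le (remainder_two_mul_le hθ hθ01 n)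
  obtain ⟨r, p, h⟩ := exists_multiple_near hθ hθ01 (x + δ / 2 - K * θ) (2 * n)
  rw [abs_le] at h
  refine ⟨K + r, -p, by omega, ?_, ?_⟩ <;> push_cast <;> linarith

/-- The letter function is right-continuous and locally constant from the right, so approaching β
from the right by the orbit of θ reproduces any finite window exactly. -/
lemma exists_window (β : ℝ) (N : ℕ) : ∃ k, N + 2 ≤ k ∧
    ∀ l : ℕ, |(l : ℤ) - k| ≤ N → letter θ (θ + l * θ) = potential θ β (l - k) := by
  have hev : ∀ᶠ t in 𝓝[≥] (0 : ℝ), ∀ i ∈ Finset.Icc (-N : ℤ) N,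
      letter θ (i * θ + β + t) = letter θ (i * θ + β) :=
    (eventually_all_finset _).2 fun i _ => eventually_letter_add hθ01 _
  obtain ⟨δ, hδ, hsub⟩ := (mem_nhdsGE_iff_exists_Ico_subset).1 hev
  obtain ⟨k, p, hk, ht⟩ := exists_multiple_right hθ hθ01 β hδ (N + 2)
  refine ⟨k, hk, fun l hl => ?_⟩
  rw [potential_eq_letter, ← hsub ht _ (Finset.mem_Icc.2 (abs_le.1 hl)),
    ← letter_add_intCast θ _ (-p)]
  congr 1
  push_cast
  ring

lemma not_escapes {lam β E : ℝ} (hE : (E : ℂ) ∈ spectrum ℂ (hamiltonian lam θ β)) (n : ℕ) :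
    ¬ Escapes (quotient θ) lam E n := by
  intro hesc
  have hopen : IsOpen {E | Escapes (quotient θ) lam E n} := by
    have h0 := (continuous_wordMatrix (quotient θ) lam n)
    have h1 := (continuous_wordMatrix (quotient θ) lam (n + 1))
    have h2 : Continuous fun E => mixedTrace (quotient θ) lam E n 1 :=
      (h0.mul (h1.pow 1)).matrix_trace
    exact (isOpen_lt continuous_const h1.matrix_trace.abs).inter
      ((isOpen_lt continuous_const h2.abs).inter (isOpen_lt h0.matrix_trace.abs h2.abs))
  obtain ⟨ε, hε, hball⟩ := Metric.isOpen_iff.1 hopen E hesc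
  obtain ⟨f, N, hf, hN⟩ := exists_finite_approx_eigenvector hE hε
  obtain ⟨k, hk, hW⟩ := exists_window hθ hθ01 β N
  -- Large enough for the word to contain the window and to come after level `n`, where escape at
  -- the nearby energy forbids trace 2.
  set m := n + k + N + 2 with hm
  have hq : k + N + 2 ≤ denom θ (m + 2) := by
    have := le_denom hθ hθ01 (m + 1)
    change m + 1 ≤ denom θ (m + 2) at this
    omega
  obtain ⟨E', hE', htr⟩ := exists_trace_eq_two hε hf hN hk hq hW
  change (transfer lam E' (factor θ θ (denom θ (m + 2)))).trace = 2 at htr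
  rw [(isLong_theta hθ hθ01 m).factor_eq hθ hθ01, transfer_word hθ hθ01 lam E' (m + 1)] at htr
  have h2 := Escapes.two_lt (one_le_quotient hθ hθ01)
    (hball (by rwa [Metric.mem_ball, Real.dist_eq])) (show n ≤ m + 1 by omega)
  rw [htr] at h2
  norm_num at h2

lemma exists_recurrence {lam β E : ℝ} {u : ℤ → ℂ} (hesc : ∀ n, ¬ Escapes (quotient θ) lam E n)
    (hu : IsSolution lam θ β E u) (n : ℕ) (j : ℤ) : ∃ (k : ℕ) (t : ℝ),
    k ∈ ({denom θ (n + 3), denom θ (n + 4), denom θ (n + 5), denom θ (n + 5) + denom θ (n + 4)} :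
      Finset ℕ) ∧ |t| ≤ 2 * traceBound lam + 2 ∧ u (j + k + k) - t * u (j + k) + u j = 0 := by
  have ha := one_le_quotient hθ hθ01
  have hb : 0 ≤ traceBound lam := by unfold traceBound; positivity
  have hlen : ∀ m, (word θ (m + 1)).length = denom θ (m + 1) := length_word hθ hθ01
  have htr : ∀ m, |(transfer lam E (word θ (m + 1))).trace| ≤ 2 * traceBound lam + 2 := by
    intro m
    rw [transfer_word hθ hθ01]
    have := abs_trace_le ha hesc (m + 1)
    linarith
  obtain ⟨w, hw, hcase⟩ := exists_startsSquare hθ hθ01 n (j * θ + β)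
  refine ⟨w.length, (transfer lam E w).trace, ?_, ?_, hw.recurrence hu⟩
  · rcases hcase with rfl | rfl | rfl | rfl
    · simp [hlen (n + 2)]
    · simp [hlen (n + 3)]
    · simp [hlen (n + 4)]
    · simp [hlen (n + 4), hlen (n + 3)]
  · rcases hcase with rfl | rfl | rfl | rfl
    · exact htr _
    · exact htr _
    · exact htr _
    · rw [transfer_append, transfer_word hθ hθ01, transfer_word hθ hθ01]
      have := abs_mixedTrace_one_le ha hesc (n + 4)
      rwa [mixedTrace, pow_one] at this

end Irrational

/-! ### Growth of mass along the denominators. -/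

lemma sum_shift_le {g : ℕ → ℝ} (hg : ∀ n, 0 ≤ g n) {d k D : ℕ} (hk : d ≤ k) (hD : k + d ≤ D) :
    ∑ j ∈ Finset.range d, g (j + k) ≤ ∑ j ∈ Finset.range D, g j - ∑ j ∈ Finset.range d, g j := by
  rw [← Finset.sum_Ico_eq_sub _ (by omega : d ≤ D)]
  have : ∑ j ∈ Finset.range d, g (j + k) = ∑ j ∈ Finset.Ico k (k + d), g j := by
    rw [Finset.sum_Ico_eq_sum_range, Nat.add_sub_cancel_left]
    exact Finset.sum_congr rfl fun j _ => by rw [add_comm]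
  rw [this]
  exact Finset.sum_le_sum_of_subset_of_nonneg (Finset.Ico_subset_Ico hk hD) fun _ _ _ => hg _

lemma norm_sq_le_of_recurrence {x y z : ℂ} {t T : ℝ} (hT : 1 ≤ T) (ht : |t| ≤ T)
    (h : z - t * y + x = 0) : ‖x‖ ^ 2 ≤ 2 * T ^ 2 * (‖y‖ ^ 2 + ‖z‖ ^ 2) := by
  have hx : x = t * y - z := by linear_combination h
  have h1 : ‖x‖ ≤ T * ‖y‖ + ‖z‖ := by
    rw [hx]
    refine (norm_sub_le _ _).trans ?_
    rw [norm_mul, Complex.norm_real, Real.norm_eq_abs]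
    gcongr
  have h2 : ‖x‖ ^ 2 ≤ (T * ‖y‖ + ‖z‖) ^ 2 := by gcongr
  have h3 : ‖z‖ ^ 2 ≤ T ^ 2 * ‖z‖ ^ 2 := le_mul_of_one_le_left (by positivity) (by nlinarith)
  nlinarith [sq_nonneg (T * ‖y‖ - ‖z‖)]

section Irrational
variable {θ : ℝ} (hθ : Irrational θ) (hθ01 : θ ∈ Set.Ioo (0 : ℝ) 1)
include hθ hθ01

/-- Mass reproduction: the mass on a longer scale exceeds that on a shorter one by a factor. -/
lemma mass_reproduction {lam β E : ℝ} {u : ℤ → ℂ} (hesc : ∀ n, ¬ Escapes (quotient θ) lam E n)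
    (hu : IsSolution lam θ β E u) (n : ℕ) :
    (1 + 1 / (16 * (2 * traceBound lam + 2) ^ 2)) *
      ∑ j ∈ Finset.range (denom θ (n + 3)), ‖u j‖ ^ 2 ≤
      ∑ j ∈ Finset.range (denom θ (n + 11)), ‖u j‖ ^ 2 := by
  have hmono := denom_mono hθ hθ01
  set d := denom θ (n + 3)
  set D := denom θ (n + 11)
  set T := 2 * traceBound lam + 2 with hTdef
  have hT : 1 ≤ T := by
    have : 0 ≤ traceBound lam := by unfold traceBound; positivity
    linarith
  set K : Finset ℕ := {denom θ (n + 3), denom θ (n + 4), denom θ (n + 5),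
    denom θ (n + 5) + denom θ (n + 4)} with hK
  have hcard : K.card ≤ 4 := Finset.card_le_four
  have hKbd : ∀ k ∈ K, d ≤ k ∧ k + k + d ≤ D := by
    have h34 : denom θ (n + 3) ≤ denom θ (n + 4) := hmono (by omega)
    have h45 : denom θ (n + 4) ≤ denom θ (n + 5) := hmono (by omega)
    have h7 : 2 * denom θ (n + 5) ≤ denom θ (n + 7) := two_mul_denom_le hθ hθ01 _
    have h9 : 2 * denom θ (n + 7) ≤ denom θ (n + 9) := two_mul_denom_le hθ hθ01 _
    have h11 : 2 * denom θ (n + 9) ≤ denom θ (n + 11) := two_mul_denom_le hθ hθ01 _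
    intro k hk
    simp only [hK, Finset.mem_insert, Finset.mem_singleton] at hk
    change denom θ (n + 3) ≤ k ∧ k + k + denom θ (n + 3) ≤ denom θ (n + 11)
    omega
  set g : ℕ → ℝ := fun j => ‖u j‖ ^ 2 with hg
  have hg0 : ∀ j, 0 ≤ g j := fun j => sq_nonneg _
  change (1 + 1 / (16 * T ^ 2)) * ∑ j ∈ Finset.range d, g j ≤ ∑ j ∈ Finset.range D, g j
  -- The period k depends on j; summing over all four candidates removes this dependence. Four
  -- periods with two shifts each give the factor 8 below.
  have hpt : ∀ j, g j ≤ 2 * T ^ 2 * ∑ k ∈ K, (g (j + k) + g (j + (k + k))) := by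
    intro j
    obtain ⟨k, t, hk, ht, hrec⟩ := exists_recurrence hθ hθ01 hesc hu n j
    have h1 := norm_sq_le_of_recurrence hT ht hrec
    have h2 : g (j + k) + g (j + (k + k)) ≤ ∑ k ∈ K, (g (j + k) + g (j + (k + k))) :=
      Finset.single_le_sum (f := fun k => g (j + k) + g (j + (k + k)))
        (fun i _ => add_nonneg (hg0 _) (hg0 _)) hk
    refine h1.trans ?_
    have h3 : ‖u (j + k)‖ ^ 2 + ‖u (j + k + k)‖ ^ 2 = g (j + k) + g (j + (k + k)) := by
      simp [hg, add_assoc]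
    rw [h3]
    gcongr
  have hsum : ∑ j ∈ Finset.range d, g j ≤ 2 * T ^ 2 *
      (8 * (∑ j ∈ Finset.range D, g j - ∑ j ∈ Finset.range d, g j)) := by
    refine (Finset.sum_le_sum fun j _ => hpt j).trans ?_
    rw [← Finset.mul_sum, Finset.sum_comm]
    gcongr
    have hdiff : 0 ≤ ∑ j ∈ Finset.range D, g j - ∑ j ∈ Finset.range d, g j := by
      rw [← Finset.sum_Ico_eq_sub _ (hmono (by omega) : d ≤ D)]
      exact Finset.sum_nonneg fun _ _ => hg0 _
    refine (Finset.sum_le_card_nsmul K _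
      (2 * (∑ j ∈ Finset.range D, g j - ∑ j ∈ Finset.range d, g j)) fun k hk => ?_).trans ?_
    · obtain ⟨h1, h2⟩ := hKbd k hk
      rw [Finset.sum_add_distrib]
      have e1 := sum_shift_le hg0 (d := d) (k := k) (D := D) h1 (by omega)
      have e2 := sum_shift_le hg0 (d := d) (k := k + k) (D := D) (by omega) (by omega)
      linarith
    · rw [nsmul_eq_mul]
      have : (K.card : ℝ) ≤ 4 := by exact_mod_cast hcard
      nlinarith
  have hT2 : 0 < 16 * T ^ 2 := by positivity
  have : (∑ j ∈ Finset.range d, g j) / (16 * T ^ 2) ≤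
      ∑ j ∈ Finset.range D, g j - ∑ j ∈ Finset.range d, g j := by
    rw [div_le_iff₀ hT2]
    linarith
  rw [add_mul, one_mul, one_div_mul_eq_div]
  linarith

lemma pow_le_mass {lam β E : ℝ} {u : ℤ → ℂ} (hesc : ∀ n, ¬ Escapes (quotient θ) lam E n)
    (hu : IsSolution lam θ β E u) (hnorm : IsNormalized u) (m : ℕ) :
    (1 + 1 / (16 * (2 * traceBound lam + 2) ^ 2)) ^ m ≤
      ∑ j ∈ Finset.range (denom θ (8 * m + 3)), ‖u j‖ ^ 2 := by
  induction m with
  | zero =>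
    rw [pow_zero, ← hnorm]
    have h2 : 2 ≤ denom θ (8 * 0 + 3) := le_denom hθ hθ01 2
    refine le_trans (le_of_eq ?_) (Finset.sum_le_sum_of_subset_of_nonneg
      (Finset.range_subset_range.2 h2) fun _ _ _ => sq_nonneg _)
    simp [Finset.sum_range_succ]
  | succ m ih =>
    rw [pow_succ']
    exact (mul_le_mul_of_nonneg_left ih (by positivity)).trans
      (mass_reproduction hθ hθ01 hesc hu (8 * m))

end Irrational

lemma mass_le_localNorm_sq (u : ℤ → ℂ) {L : ℝ} (hL : 0 ≤ L) {d : ℕ} (hd : (d : ℝ) ≤ L) :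
    ∑ j ∈ Finset.range d, ‖u j‖ ^ 2 ≤ localNorm u L ^ 2 := by
  have h1 : 0 ≤ (L - (⌊L⌋₊ : ℝ)) * ‖u ((⌊L⌋₊ : ℤ) + 1)‖ ^ 2 :=
    mul_nonneg (sub_nonneg.2 (Nat.floor_le hL)) (sq_nonneg _)
  have h2 : ∑ j ∈ Finset.range d, ‖u j‖ ^ 2 ≤ ∑ n ∈ Finset.range (⌊L⌋₊ + 1), ‖u (n : ℤ)‖ ^ 2 :=
    Finset.sum_le_sum_of_subset_of_nonneg
      (Finset.range_subset_range.2 ((Nat.le_floor hd).trans (Nat.le_succ _)))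
      fun _ _ _ => sq_nonneg _
  rw [localNorm, Real.sq_sqrt]
  · linarith
  · exact add_nonneg (Finset.sum_nonneg fun _ _ => sq_nonneg _) h1

end Sturmian

/-! ### From geometric growth in the level to a power law. -/

theorem proposition4p1 (θ : ℝ) (hθ : Irrational θ) (hθ01 : θ ∈ Set.Ioo (0 : ℝ) 1)
    (hq : ∃ B : ℝ, ∀ n : ℕ, Sturmian.cfDenom θ n ≤ B ^ n) :
    ∀ lam : ℝ, lam ≠ 0 → ∃ γ₁ C₁ : ℝ, 0 < γ₁ ∧ 0 < C₁ ∧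
      -- The spectrum does not depend on the phase, so the phase `β₀` that defines it
      -- and the phase `β` of the difference equation are quantified separately.
      ∀ β₀ ∈ Set.Ico (0 : ℝ) 1, ∀ E : ℝ, (E : ℂ) ∈ spectrum ℂ (Sturmian.hamiltonian lam θ β₀) →
        ∀ β ∈ Set.Ico (0 : ℝ) 1, ∀ u : ℤ → ℂ,
          Sturmian.IsSolution lam θ β E u → Sturmian.IsNormalized u →
            ∀ᶠ L : ℝ in Filter.atTop, C₁ * L ^ γ₁ ≤ Sturmian.localNorm u L := by
  obtain ⟨B, hB⟩ := hq
  intro lam _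
  set b : ℝ := max |B| 2 with hb
  have hb2 : 2 ≤ b := le_max_right _ _
  have hden : ∀ n : ℕ, (Sturmian.denom θ (n + 1) : ℝ) ≤ b ^ n := by
    intro n
    rw [← Sturmian.cfDenom_eq_denom hθ hθ01]
    refine (hB n).trans ((le_abs_self _).trans ?_)
    rw [abs_pow]
    exact pow_le_pow_left₀ (abs_nonneg _) (le_max_left _ _) _
  set ρ : ℝ := 1 + 1 / (16 * (2 * Sturmian.traceBound lam + 2) ^ 2) with hρ
  have hρ1 : 1 < ρ := by
    have : 0 ≤ Sturmian.traceBound lam := by unfold Sturmian.traceBound; positivity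
    rw [hρ, lt_add_iff_pos_right]
    positivity
  have hρ0 : 0 < ρ := by linarith
  have hb8 : 1 < b ^ 8 := one_lt_pow₀ (by linarith) (by norm_num)
  have hlog : 0 < Real.log (b ^ 8) := Real.log_pos hb8
  -- Eight levels cost a factor b⁸ in length and gain ρ in squared norm, hence (b⁸)^(2γ) = ρ.
  set γ : ℝ := Real.log ρ / (2 * Real.log (b ^ 8)) with hγ
  have hγpos : 0 < γ := div_pos (Real.log_pos hρ1) (by positivity)
  have hbγ : (b ^ 8) ^ (2 * γ) = ρ := by
    rw [Real.rpow_def_of_pos (by positivity), show Real.log (b ^ 8) * (2 * γ) = Real.log ρ by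
      rw [hγ]; field_simp, Real.exp_log hρ0]
  refine ⟨γ, ρ⁻¹, hγpos, inv_pos.2 hρ0, ?_⟩
  intro β₀ _ E hE β _ u hu hnorm
  have hesc := Sturmian.not_escapes hθ hθ01 hE
  filter_upwards [Filter.eventually_ge_atTop (b ^ 2)] with L hL
  have hL0 : 0 < L := lt_of_lt_of_le (by positivity) hL
  -- Dividing by b² accounts for the starting index: `denom θ (8 * m + 3)` is at most b^(8m+2).
  -- Rounding L up to (b⁸)^(m+2) loses ρ², which the constant ρ⁻¹ absorbs after squaring.
  obtain ⟨m, hm1, hm2⟩ := exists_nat_pow_near (x := L / b ^ 2) (y := b ^ 8)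
    ((one_le_div (by positivity)).2 hL) hb8
  rw [le_div_iff₀ (by positivity)] at hm1
  rw [div_lt_iff₀ (by positivity)] at hm2
  have hmass : ρ ^ m ≤ Sturmian.localNorm u L ^ 2 := by
    refine (Sturmian.pow_le_mass hθ hθ01 hesc hu hnorm m).trans
      (Sturmian.mass_le_localNorm_sq u hL0.le ((hden (8 * m + 2)).trans ?_))
    rwa [pow_add, pow_mul]
  have hLle : L ≤ (b ^ 8) ^ (m + 2) := by
    have : b ^ 2 ≤ b ^ 8 := pow_le_pow_right₀ (by linarith) (by norm_num)
    calc L ≤ (b ^ 8) ^ (m + 1) * b ^ 2 := hm2.le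
      _ ≤ (b ^ 8) ^ (m + 1) * b ^ 8 := by gcongr
      _ = (b ^ 8) ^ (m + 2) := (pow_succ _ _).symm
  have hLγ : (L ^ γ) ^ 2 ≤ ρ ^ (m + 2) := by
    calc (L ^ γ) ^ 2 = L ^ (2 * γ) := by
          rw [← Real.rpow_natCast, ← Real.rpow_mul hL0.le, mul_comm]; norm_num
      _ ≤ ((b ^ 8) ^ (m + 2)) ^ (2 * γ) := by gcongr
      _ = ((b ^ 8) ^ (2 * γ)) ^ (m + 2) := (Real.rpow_pow_comm (by positivity) _ _).symm
      _ = ρ ^ (m + 2) := by rw [hbγ]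
  refine le_of_sq_le_sq ?_ (Real.sqrt_nonneg _)
  refine le_trans ?_ hmass
  rw [mul_pow, inv_pow, inv_mul_le_iff₀ (by positivity), ← pow_add, add_comm 2 m]
  exact hLγ
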